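/- **Setting.** Let $G$ and $H$ be groups with finite generating sets $S_G$ and $S_H$. The Cayley graph of $(G,S_G)$ has an edge labelled $s$ from $g$ to $gs$ for all $g\in G$, $s\in S_G$. Every directed labelled graph carries its path metric $d$, where edges may be traversed in both directions and $d=\infty$ between different components; balls $B(x,r)$ are closed, and $\operatorname{diam}\emptyset=0$. A *sofic approximation* of $G$ is a sequence $(\mathcal G_n)_{n\in\mathbb N}$ of finite directed graphs with edges labelled by $S_G$ such that for every $r$ the proportion of vertices $x\in\mathcal G_n$ for which $B_{\mathcal G_n}(x,r)$ is isomorphic, as a rooted directed labelled graph, to the ball $B_G(e_G,r)$ of the Cayley graph tends to $1$ as $n\to\infty$. Write $\mathbb P_X$ for the uniform probability on a finite set $X$. Let $(\mathcal G_n)$ and $(\mathcal H_n)$ be sofic approximations of $G$ and $H$, let $\mathcal U$ be a non-principal ultrafilter on $\mathbb N$, and let $\mathfrak u_n\colon\mathcal G_n\to\mathcal H_n$ be maps between the vertex sets. The sequence $(\mathfrak u_n)$ is *$\mathcal U$-statistically a coarse equivalence* if, for every $r>0$, * (Lipschitz) $\lim_{C\to\infty}\lim_{\mathcal U}\mathbb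 P_{\mathcal G_n}\{x : \operatorname{diam}_{\mathcal H_n}(\mathfrak u_n(B_{\mathcal G_n}(x,r)))\ge C\}=0$; * (expansive) $\lim_{C\to\infty}\lim_{\mathcal U}\mathbb P_{\mathcal G_n}\{x : \operatorname{diam}_{\mathcal G_n}(\mathfrak u_n^{-1}(B_{\mathcal H_n}(\mathfrak u_n(x),r)))\ge C\}=0$; and moreover * (coarsely injective) $\lim_{C\to\infty}\lim_{\mathcal U}\mathbb P_{\mathcal G_n}\{x : \operatorname{diam}_{\mathcal G_n}(\mathfrak u_n^{-1}(\mathfrak u_n(x)))\ge C\}=0$; * (coarsely surjective) $\lim_{C\to\infty}\lim_{\mathcal U}\mathbb P_{\mathcal H_n}\{z : d_{\mathcal H_n}(z,\mathfrak u_n(\mathcal G_n))\ge C\}=0$. A *measure equivalence (ME) coupling from $G$ to $H$* is a quadruple $(\Omega,X_G,X_H,\mu)$ where $(\Omega,\mu)$ is a standard Borel space with a $\sigma$-finite measure and commuting measure preserving actions of $G$ and of $H$, each of them free, and $X_G,X_H\subseteq\Omega$ are Borel fundamental domains for $G$ and $H$ (their translates cover $\Omega$ up to a null set and distinct translates meet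 in a null set) with $\mu(X_H)=1$ and $\mu(X_G)<\infty$. It is *cobounded from $G$ to $H$* if $\mu(X_G\setminus F X_H)=0$ for some finite $F\subseteq H$, *cobounded from $H$ to $G$* if $\mu(X_H\setminus F X_G)=0$ for some finite $F\subseteq G$, and an *orbit equivalence (OE) coupling* if $X_G=X_H$. **Theorem 1.5.** If $(\mathfrak u_n)$ is $\mathcal U$-statistically a coarse equivalence, then there is an ME coupling $(\Omega,X_G,X_H,\mu)$ from $G$ to $H$ with $$\frac{\mu(X_G)}{\mu(X_H)}=\lim_{\mathcal U}\frac{\#\mathcal H_n}{\#\mathcal G_n},$$ and such that, moreover: * if there is $C>0$ such that every point of every $\mathcal H_n$ is at distance at most $C$ from $\mathfrak u_n(\mathcal G_n)$, then the coupling is cobounded from $G$ to $H$; * if there is $C>0$ such that all point-preimages of all the maps $\mathfrak u_n$ have diameter at most $C$, then the coupling is cobounded from $H$ to $G$; * if all the maps $\mathfrak u_n$ are bijective, then the coupling is an OE coupling. -/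

import Mathlib

open Filter Topology MeasureTheory
open scoped ENNReal Pointwise

universe u v w₁ w₂ w₃ w₄

/-- A directed graph on the vertex set `V` whose edges carry labels in `L`:
`Γ.Edge l x y` says that there is an edge labelled `l` from `x` to `y`.
Loops, and several edges with different labels between two vertices, are allowed. -/
structure LabelledDigraph (L : Type w₁) (V : Type w₂) where
  Edge : L → V → V → Prop

namespace LabelledDigraph

variable {L : Type w₁} {V : Type w₂}

/-- The undirected simple graph underlying `Γ` (labels, directions and loops are forgotten). -/
def underlying (Γ : LabelledDigraph L V) : SimpleGraph V :=
  SimpleGraph.fromRel fun x y => ∃ l, Γ.Edge l x y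

/-- The path metric of `Γ`: the least number of edges, traversed in either direction, in a path
from `x` to `y`. It is `⊤` if there is no such path. -/
noncomputable def dist (Γ : LabelledDigraph L V) (x y : V) : ℕ∞ :=
  Γ.underlying.edist x y

/-- The closed ball of radius `r` about `x` for the path metric. -/
def ball (Γ : LabelledDigraph L V) (x : V) (r : ℕ) : Set V :=
  {y | Γ.dist x y ≤ r}

/-- The diameter of a set of vertices for the path metric of the whole graph. -/
noncomputable def diam (Γ : LabelledDigraph L V) (A : Set V) : ℕ∞ :=
  ⨆ x ∈ A, ⨆ y ∈ A, Γ.dist x y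

end LabelledDigraph

/-- The Cayley graph of `G` with respect to `S`: an edge labelled `s` from `g` to `g * s` for all
`g : G` and `s ∈ S`. Its path metric is the left-invariant word metric of `S`. -/
def cayleyGraph {G : Type u} [Group G] (S : Finset G) : LabelledDigraph S G where
  Edge s g g' := g' = g * s

/-- The set of vertices `x` of `Γ` whose `r`-ball is isomorphic, as a directed labelled graph and
by an isomorphism that takes the centre to the centre, to the `r`-ball about the identity of the
Cayley graph of `(G, S)`. Balls carry the induced graph structure. -/
def goodVertices {G : Type u} [Group G] (S : Finset G) {V : Type w₁}
    (Γ : LabelledDigraph S V) (r : ℕ) : Set V :=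
  {x | ∃ θ : (cayleyGraph S).ball 1 r ≃ Γ.ball x r,
    (∀ a : (cayleyGraph S).ball 1 r, (a : G) = 1 → (θ a : V) = x) ∧
    ∀ (s : S) (a b : (cayleyGraph S).ball 1 r),
      (cayleyGraph S).Edge s a b ↔ Γ.Edge s (θ a) (θ b)}

/-- The uniform probability of the subset `A` of the finite set `V`. -/
noncomputable def uniformProb {V : Type w₁} (A : Set V) : ℝ :=
  (A.ncard : ℝ) / (Nat.card V : ℝ)

/-- The sequence of finite `S`-labelled directed graphs `𝒢 n` is a sofic approximation of
`(G, S)`: for every `r`, the proportion of vertices with a good `r`-ball tends to `1`. -/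
def IsSoficApproximation {G : Type u} [Group G] (S : Finset G) {V : ℕ → Type w₁}
    (𝒢 : ∀ n, LabelledDigraph S (V n)) : Prop :=
  ∀ r : ℕ, Tendsto (fun n => uniformProb (goodVertices S (𝒢 n) r)) atTop (𝓝 1)

/-- `lim_{C → ∞} lim_{n → U} p C n = 0`, where all the limits are required to exist. -/
def IteratedLimZero (U : Ultrafilter ℕ) (p : ℕ → ℕ → ℝ) : Prop :=
  ∃ q : ℕ → ℝ, (∀ C, Tendsto (p C) U (𝓝 (q C))) ∧ Tendsto q atTop (𝓝 0)

section Statistical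

variable {L : Type w₁} {M : Type w₂} {V : ℕ → Type w₃} {W : ℕ → Type w₄}

/-- `U`-statistical coarse injectivity of the maps `u n` between the metric spaces `𝒢 n`, `ℋ n`;
the metric of the target plays no role. -/
def StatCoarselyInjective (U : Ultrafilter ℕ) (𝒢 : ∀ n, LabelledDigraph L (V n))
    (u : ∀ n, V n → W n) : Prop :=
  IteratedLimZero U fun C n =>
    uniformProb {x : V n | (C : ℕ∞) ≤ (𝒢 n).diam (u n ⁻¹' {u n x})}

/-- `U`-statistical coarse surjectivity; the metric of the source plays no role. -/
def StatCoarselySurjective (U : Ultrafilter ℕ) (ℋ : ∀ n, LabelledDigraph M (W n))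
    (u : ∀ n, V n → W n) : Prop :=
  IteratedLimZero U fun C n =>
    uniformProb {z : W n | (C : ℕ∞) ≤ ⨅ x, (ℋ n).dist z (u n x)}

/-- The maps `u n` are `U`-statistically Lipschitz. -/
def StatLipschitz (U : Ultrafilter ℕ) (𝒢 : ∀ n, LabelledDigraph L (V n))
    (ℋ : ∀ n, LabelledDigraph M (W n)) (u : ∀ n, V n → W n) : Prop :=
  ∀ r : ℕ, IteratedLimZero U fun C n =>
    uniformProb {x : V n | (C : ℕ∞) ≤ (ℋ n).diam (u n '' (𝒢 n).ball x r)}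

/-- The maps `u n` are `U`-statistically expansive. -/
def StatExpansive (U : Ultrafilter ℕ) (𝒢 : ∀ n, LabelledDigraph L (V n))
    (ℋ : ∀ n, LabelledDigraph M (W n)) (u : ∀ n, V n → W n) : Prop :=
  ∀ r : ℕ, IteratedLimZero U fun C n =>
    uniformProb {x : V n | (C : ℕ∞) ≤ (𝒢 n).diam (u n ⁻¹' (ℋ n).ball (u n x) r)}

/-- The maps `u n` are `U`-statistically a coarse equivalence. -/
structure StatCoarseEquivalence (U : Ultrafilter ℕ) (𝒢 : ∀ n, LabelledDigraph L (V n))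
    (ℋ : ∀ n, LabelledDigraph M (W n)) (u : ∀ n, V n → W n) : Prop where
  lipschitz : StatLipschitz U 𝒢 ℋ u
  expansive : StatExpansive U 𝒢 ℋ u
  coarselyInjective : StatCoarselyInjective U 𝒢 u
  coarselySurjective : StatCoarselySurjective U ℋ u

end Statistical

/-- A measure equivalence coupling `(Ω, X_G, X_H, μ)` from `G` to `H`: a standard Borel space with
a σ-finite measure and commuting, free, measure preserving actions of `G` and `H`, with Borel
fundamental domains `X_G` of finite measure and `X_H` of measure `1`.
(`IsFundamentalDomain` means that the translates cover `Ω` up to a null set and that distinct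
translates have null intersection.) -/
structure MECoupling (G : Type u) (H : Type v) [Group G] [Group H] where
  Ω : Type (max u v)
  [measurableSpace : MeasurableSpace Ω]
  [standardBorelSpace : StandardBorelSpace Ω]
  [actionG : MulAction G Ω]
  [actionH : MulAction H Ω]
  [commute : SMulCommClass G H Ω]
  μ : Measure Ω
  [sigmaFinite : SigmaFinite μ]
  measurePreservingG : ∀ g : G, MeasurePreserving (fun x : Ω => g • x) μ μ
  measurePreservingH : ∀ h : H, MeasurePreserving (fun x : Ω => h • x) μ μ
  freeG : ∀ (g : G) (x : Ω), g • x = x → g = 1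
  freeH : ∀ (h : H) (x : Ω), h • x = x → h = 1
  XG : Set Ω
  XH : Set Ω
  measurableSetXG : MeasurableSet XG
  measurableSetXH : MeasurableSet XH
  fundamentalDomainXG : IsFundamentalDomain G XG μ
  fundamentalDomainXH : IsFundamentalDomain H XH μ
  measureXG : μ XG < ∞
  measureXH : μ XH = 1

namespace MECoupling

variable {G : Type u} {H : Type v} [Group G] [Group H]

attribute [instance] measurableSpace standardBorelSpace actionG actionH commute sigmaFinite

/-- The ratio `μ(Ω/G) / μ(Ω/H)` of the covolumes of the two actions. -/
noncomputable def covolumeRatio (c : MECoupling G H) : ℝ≥0∞ := c.μ c.XG / c.μ c.XH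

/-- Coboundedness from `G` to `H`: up to a null set, the fundamental domain of `G` is contained in
finitely many translates (under `H`) of the fundamental domain of `H`. -/
def CoboundedGToH (c : MECoupling G H) : Prop :=
  ∃ F : Finset H, c.μ (c.XG \ ⋃ h ∈ F, h • c.XH) = 0

/-- Coboundedness from `H` to `G`: up to a null set, the fundamental domain of `H` is contained in
finitely many translates (under `G`) of the fundamental domain of `G`. -/
def CoboundedHToG (c : MECoupling G H) : Prop :=
  ∃ F : Finset G, c.μ (c.XH \ ⋃ g ∈ F, g • c.XG) = 0

/-- The coupling is an orbit equivalence coupling: the two actions share the fundamental domain. -/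
def IsOE (c : MECoupling G H) : Prop := c.XG = c.XH

end MECoupling

/-! On most vertices a sofic approximation carries an approximate free right action of the group, `x
↦ x·g`, obtained by following a word for `g`. Let `s` send each `z : W n` to a point `x` for which
`u x` is as close to `z` as possible. Around a vertex `x`, the maps `u` and `s` are recorded by a
pair `α : G → H`, `β : H → G` with `u (x·g) = u x·α g` and `s (u x·h) = x·β h`. The Lipschitz
condition makes each value of `α` tight, and expansivity does the same for `β`. So the laws of these
pairs for uniform `x` have a weak ultralimit `P` on the space of pairs (`exists_ultralimit`).

Changing `x` to `x·g` almost preserves the uniform measure and replaces `(α, β)` by the pair seen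
from `x·g` and `u (x·g)`. Hence `P` is invariant under `reroot` (`map_reroot_eq`), and it lives on
`α 1 = 1`. The groups act on all pairs, and summing the translates of `P` over `H` gives an
invariant measure, for which `α 1 = 1` defines a fundamental domain of `H` and `β 1 = 1` one of `G`
(`exists_coupling`).

The first domain has measure one and the second has measure `∑ P (β h = 1)`, summed over `h`. The
event `β h = 1` says `s (u x·h) = x`. Since almost every `z` is `u (s z)·h` for exactly one `h`,
these events together count the points of `W n`, so the sum is the limit of the ratios of
cardinalities (`sum_uniformProb_le_ratio`, `ratio_le_sum_uniformProb`). Coarse surjectivity keeps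
mass from escaping to infinite `h`; with coarse injectivity it also ensures that `u` pulls
negligible sets back to negligible sets (`tendsto_statFilter_map`).

Uniform density of the images leaves finitely many `h` with `β h = 1`, bounded fibres confine `β 1`
to a finite set, and for bijections `β h = 1` happens exactly at `h = 1`. -/

/-! ### Uniform probability on finite sets. -/

section UniformProb

variable {V : Type w₁}

theorem uniformProb_nonneg (A : Set V) : 0 ≤ uniformProb A := by
  unfold uniformProb; positivity

theorem uniformProb_empty : uniformProb (∅ : Set V) = 0 := by simp [uniformProb]

theorem uniformProb_union_le (A B : Set V) :
    uniformProb (A ∪ B) ≤ uniformProb A + uniformProb B := by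
  unfold uniformProb
  rw [← add_div]
  have : ((A ∪ B).ncard : ℝ) ≤ A.ncard + B.ncard := mod_cast Set.ncard_union_le A B
  gcongr

variable [Finite V]

theorem uniformProb_mono {A B : Set V} (h : A ⊆ B) : uniformProb A ≤ uniformProb B := by
  unfold uniformProb
  have := Set.ncard_le_ncard h (Set.toFinite B)
  gcongr

theorem uniformProb_le_add {A B C : Set V} (h : A ⊆ B ∪ C) :
    uniformProb A ≤ uniformProb B + uniformProb C :=
  (uniformProb_mono h).trans (uniformProb_union_le B C)

theorem abs_uniformProb_sub_le (A B : Set V) :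
    |uniformProb A - uniformProb B| ≤ uniformProb {x | ¬ (x ∈ A ↔ x ∈ B)} := by
  have h1 : A ⊆ B ∪ {x | ¬ (x ∈ A ↔ x ∈ B)} := fun x hx => by
    by_cases h : x ∈ B
    · exact Or.inl h
    · exact Or.inr fun h' => h (h'.1 hx)
  have h2 : B ⊆ A ∪ {x | ¬ (x ∈ A ↔ x ∈ B)} := fun x hx => by
    by_cases h : x ∈ A
    · exact Or.inl h
    · exact Or.inr fun h' => h (h'.2 hx)
  have h3 := uniformProb_le_add h1
  have h4 := uniformProb_le_add h2
  rw [abs_le]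
  constructor <;> linarith

theorem uniformProb_compl [Nonempty V] (A : Set V) : uniformProb Aᶜ = 1 - uniformProb A := by
  unfold uniformProb
  have h0 : (Nat.card V : ℝ) ≠ 0 := by exact_mod_cast Nat.card_pos.ne'
  have : (A.ncard : ℝ) + (Aᶜ.ncard : ℝ) = Nat.card V := mod_cast Set.ncard_add_ncard_compl A
  field_simp
  linarith

theorem uniformProb_image_le (f : V → V) (A : Set V) : uniformProb (f '' A) ≤ uniformProb A := by
  unfold uniformProb
  have := Set.ncard_image_le (f := f) (Set.toFinite A)
  gcongr

end UniformProb

/-! ### Events of limiting probability one, and tightness. -/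

section StatFilter

variable {V : ℕ → Type w₁} [∀ n, Finite (V n)] {U : Ultrafilter ℕ}

/-- The filter of the families of subsets of the finite sets `V n` whose uniform probability
tends to `1` along `U` (expressed through the complements). -/
def statFilter (U : Ultrafilter ℕ) (V : ℕ → Type w₁) [∀ n, Finite (V n)] :
    Filter (Σ n, V n) where
  sets := {A | Tendsto (fun n => uniformProb {x : V n | (⟨n, x⟩ : Σ n, V n) ∉ A}) U (𝓝 0)}
  univ_sets := by simp [uniformProb_empty]
  sets_of_superset := by
    intro A B hA hAB
    refine squeeze_zero (fun n => uniformProb_nonneg _) (fun n => uniformProb_mono ?_) hA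
    intro x hx hxA
    exact hx (hAB hxA)
  inter_sets := by
    intro A B hA hB
    refine squeeze_zero (fun n => uniformProb_nonneg _) (fun n => ?_)
      (by simpa using Tendsto.add hA hB)
    refine uniformProb_le_add fun x hx => ?_
    by_contra h
    simp only [Set.mem_union, Set.mem_ofPred_eq, not_or, not_not] at h hx
    exact hx h

theorem eventually_statFilter {Q : (Σ n, V n) → Prop} :
    (∀ᶠ p in statFilter U V, Q p) ↔
      Tendsto (fun n => uniformProb {x : V n | ¬ Q ⟨n, x⟩}) U (𝓝 0) := Iff.rfl

theorem eventually_statFilter_of_le {Q : (Σ n, V n) → Prop}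
    (h : ∀ ε > 0, ∀ᶠ n in (U : Filter ℕ), uniformProb {x : V n | ¬ Q ⟨n, x⟩} ≤ ε) :
    ∀ᶠ p in statFilter U V, Q p := by
  rw [eventually_statFilter, Metric.tendsto_nhds]
  intro ε hε
  filter_upwards [h (ε / 2) (by positivity)] with n hn
  rw [Real.dist_eq, sub_zero, abs_of_nonneg (uniformProb_nonneg _)]
  linarith

theorem Filter.Eventually.uniformProb_le {Q : (Σ n, V n) → Prop}
    (h : ∀ᶠ p in statFilter U V, Q p) {ε : ℝ} (hε : 0 < ε) :
    ∀ᶠ n in (U : Filter ℕ), uniformProb {x : V n | ¬ Q ⟨n, x⟩} ≤ ε :=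
  ((tendsto_order.1 (eventually_statFilter.1 h)).2 ε hε).mono fun _ hn => hn.le

/-- The witnesses of a property can be found in a finite set, with probability close to `1`. -/
def TightlyExists (U : Ultrafilter ℕ) {D : Type*} (p : (Σ n, V n) → D → Prop) : Prop :=
  ∀ ε > 0, ∃ F : Finset D, ∀ᶠ n in (U : Filter ℕ),
    uniformProb {x : V n | ¬ ∃ a ∈ F, p ⟨n, x⟩ a} ≤ ε

theorem TightlyExists.eventually_exists {D : Type*} {p : (Σ n, V n) → D → Prop}
    (h : TightlyExists U p) : ∀ᶠ q in statFilter U V, ∃ a, p q a := by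
  refine eventually_statFilter_of_le fun ε hε => ?_
  obtain ⟨F, hF⟩ := h ε hε
  filter_upwards [hF] with n hn
  refine (uniformProb_mono ?_).trans hn
  rintro x hx ⟨a, -, ha⟩
  exact hx ⟨a, ha⟩

/-- Only finitely many witnesses matter up to `ε`, so implications known for each fixed witness can
be intersected. -/
theorem TightlyExists.mono {D : Type*} {p q : (Σ n, V n) → D → Prop}
    (h : TightlyExists U p) (hpq : ∀ a, ∀ᶠ y in statFilter U V, p y a → q y a) :
    TightlyExists U q := by
  intro ε hε
  obtain ⟨F, hF⟩ := h (ε / 2) (by positivity)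
  refine ⟨F, ?_⟩
  have h2 : ∀ᶠ y in statFilter U V, ∀ a ∈ F, p y a → q y a :=
    (Filter.eventually_all_finset F).2 fun a _ => hpq a
  filter_upwards [hF, h2.uniformProb_le (half_pos hε)] with n hn hn2
  refine (uniformProb_le_add (B := {x : V n | ¬ ∃ a ∈ F, p ⟨n, x⟩ a})
    (C := {x : V n | ¬ ∀ a ∈ F, p ⟨n, x⟩ a → q ⟨n, x⟩ a}) ?_).trans (by linarith)
  intro x hx
  by_contra hcon
  simp only [Set.mem_union, Set.mem_ofPred_eq, not_or, not_not] at hcon hx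
  obtain ⟨⟨a, ha, hpa⟩, h3⟩ := hcon
  exact hx ⟨a, ha, h3 a ha hpa⟩

/-- The values of the map `X` are in a finite set, with probability close to `1`. -/
def StatTight (U : Ultrafilter ℕ) {D : Type*} (X : (Σ n, V n) → D) : Prop :=
  TightlyExists U fun p a => X p = a

/-- To prove that a property holds with limiting probability `1`, one may condition on the value
of a tight map. -/
theorem StatTight.eventually {D : Type*} {X : (Σ n, V n) → D} (hX : StatTight U X)
    {Q : (Σ n, V n) → Prop} (h : ∀ a, ∀ᶠ p in statFilter U V, X p = a → Q p) :
    ∀ᶠ p in statFilter U V, Q p :=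
  ((TightlyExists.mono hX (q := fun p _ => Q p) h).eventually_exists).mono fun _ ⟨_, hq⟩ => hq

/-- A choice of witnesses that stays in a finite set as long as some witness does. -/
theorem exists_tight_choice (D : Type*) [Countable D] [Nonempty D] :
    ∃ pick : (D → Prop) → D, ∀ F : Finset D, ∃ F' : Finset D, ∀ p : D → Prop,
      (∃ a ∈ F, p a) → pick p ∈ F' ∧ p (pick p) := by
  classical
  obtain ⟨e, he⟩ := exists_injective_nat D
  -- The chosen witness is the first one in an enumeration `e`. If some witness lies in `F`, the
  -- choice has index at most the maximum of `e` on `F`, and only finitely many elements do.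
  have h1 : ∀ p : D → Prop, ∃ a, (∃ b, p b) → p a ∧ ∀ b, p b → e a ≤ e b := by
    intro p
    by_cases h : ∃ b, p b
    · have h2 : ({b | p b} : Set D).Nonempty := h
      exact ⟨Function.argminOn e _ h2, fun _ => ⟨Function.argminOn_mem e _ h2,
        fun b hb => Function.argminOn_le e _ hb⟩⟩
    · exact ⟨Classical.arbitrary D, fun h' => absurd h' h⟩
  choose pick hpick using h1
  refine ⟨pick, fun F => ?_⟩
  have hfin : {a | e a ≤ F.sup e}.Finite := (Set.finite_Iic (F.sup e)).preimage he.injOn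
  refine ⟨hfin.toFinset, ?_⟩
  rintro p ⟨a, ha, hpa⟩
  obtain ⟨h2, h3⟩ := hpick p ⟨a, hpa⟩
  refine ⟨?_, h2⟩
  simp only [Set.Finite.mem_toFinset, Set.mem_ofPred_eq]
  exact (h3 a hpa).trans (Finset.le_sup ha)

theorem TightlyExists.exists_statTight {D : Type*} {pick : (D → Prop) → D}
    (hpick : ∀ F : Finset D, ∃ F' : Finset D, ∀ p : D → Prop,
      (∃ a ∈ F, p a) → pick p ∈ F' ∧ p (pick p)) {p : (Σ n, V n) → D → Prop}
    (h : TightlyExists U p) :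
    StatTight U (fun y => pick (p y)) ∧ ∀ᶠ y in statFilter U V, p y (pick (p y)) := by
  constructor
  · intro ε hε
    obtain ⟨F, hF⟩ := h ε hε
    obtain ⟨F', hF'⟩ := hpick F
    refine ⟨F', hF.mono fun n hn => (uniformProb_mono ?_).trans hn⟩
    intro x hx hex
    exact hx ⟨_, (hF' _ hex).1, rfl⟩
  · refine h.eventually_exists.mono ?_
    rintro y ⟨a, ha⟩
    obtain ⟨F', hF'⟩ := hpick {a}
    exact (hF' (p y) ⟨a, by simp, ha⟩).2

end StatFilter

/-! ### The path metric, and paths that follow words. -/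

namespace LabelledDigraph

section Dist

variable {L : Type w₁} {V : Type w₂} (Γ : LabelledDigraph L V)

theorem dist_self (x : V) : Γ.dist x x = 0 := SimpleGraph.edist_self

theorem dist_comm (x y : V) : Γ.dist x y = Γ.dist y x := SimpleGraph.edist_comm

theorem dist_triangle (x y z : V) : Γ.dist x z ≤ Γ.dist x y + Γ.dist y z :=
  SimpleGraph.edist_triangle

theorem dist_eq_zero_iff {x y : V} : Γ.dist x y = 0 ↔ x = y := SimpleGraph.edist_eq_zero_iff

theorem dist_le_one_of_edge {l : L} {x y : V} (h : Γ.Edge l x y) : Γ.dist x y ≤ 1 := by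
  refine SimpleGraph.edist_le_one_iff_adj_or_eq.2 ?_
  by_cases hxy : x = y
  · exact Or.inr hxy
  · exact Or.inl ((SimpleGraph.fromRel_adj _ _ _).2 ⟨hxy, Or.inl ⟨l, h⟩⟩)

theorem mem_ball_self (x : V) (r : ℕ) : x ∈ Γ.ball x r := by
  simp [ball, dist_self]

theorem dist_le_diam {A : Set V} {x y : V} (hx : x ∈ A) (hy : y ∈ A) : Γ.dist x y ≤ Γ.diam A :=
  le_trans (le_biSup (fun y => Γ.dist x y) hy)
    (le_biSup (fun x => ⨆ y ∈ A, Γ.dist x y) hx)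

end Dist

section Walk

variable {L : Type w₁} {V : Type w₂} (Γ : LabelledDigraph L V)

open Classical in
/-- Follow from `x` an edge with the label `l.1`, forwards or backwards according to `l.2`; stay
at `x` if there is none. -/
noncomputable def step (l : L × Bool) (x : V) : V :=
  if h : ∃ y, cond l.2 (Γ.Edge l.1 x y) (Γ.Edge l.1 y x) then h.choose else x

theorem dist_step_le (l : L × Bool) (x : V) : Γ.dist x (Γ.step l x) ≤ 1 := by
  unfold step
  split_ifs with h
  · have := h.choose_spec
    obtain ⟨l, b⟩ := l
    cases b
    · rw [dist_comm]; exact Γ.dist_le_one_of_edge this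
    · exact Γ.dist_le_one_of_edge this
  · simp [dist_self]

theorem step_spec {l : L × Bool} {x : V}
    (h : ∃ y, cond l.2 (Γ.Edge l.1 x y) (Γ.Edge l.1 y x)) :
    cond l.2 (Γ.Edge l.1 x (Γ.step l x)) (Γ.Edge l.1 (Γ.step l x) x) := by
  unfold step
  rw [dif_pos h]
  exact h.choose_spec

/-- Follow a word, the last letter first. -/
noncomputable def follow : List (L × Bool) → V → V
  | [], x => x
  | l :: w, x => Γ.step l (follow w x)

theorem follow_append (w₁ w₂ : List (L × Bool)) (x : V) :
    Γ.follow (w₁ ++ w₂) x = Γ.follow w₁ (Γ.follow w₂ x) := by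
  induction w₁ with
  | nil => rfl
  | cons l w ih => simp [follow, ih]

theorem dist_follow_le (w : List (L × Bool)) (x : V) : Γ.dist x (Γ.follow w x) ≤ w.length := by
  induction w with
  | nil => simp [follow, dist_self]
  | cons l w ih =>
    refine (Γ.dist_triangle _ (Γ.follow w x) _).trans ?_
    simp only [List.length_cons, Nat.cast_add, Nat.cast_one]
    exact add_le_add ih (Γ.dist_step_le _ _)

end Walk

end LabelledDigraph

/-! ### Words in the generators, and good balls. -/

section Word

variable {G : Type u} [Group G] {S : Finset G}

/-- The group element of a letter. -/
def letterValue (l : S × Bool) : G := cond l.2 (l.1 : G) (l.1 : G)⁻¹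

/-- The group element of a word, the last letter of the list being the leftmost factor. -/
def wordValue : List (S × Bool) → G
  | [] => 1
  | l :: w => wordValue w * letterValue l

theorem wordValue_append (w₁ w₂ : List (S × Bool)) :
    wordValue (w₁ ++ w₂) = wordValue w₂ * wordValue w₁ := by
  induction w₁ with
  | nil => simp [wordValue]
  | cons l w ih => simp [wordValue, ih, mul_assoc]

theorem exists_wordValue_eq (hS : Subgroup.closure (S : Set G) = ⊤) (g : G) :
    ∃ w : List (S × Bool), wordValue w = g := by
  have hg : g ∈ Subgroup.closure (S : Set G) := hS ▸ Subgroup.mem_top g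
  induction hg using Subgroup.closure_induction_right with
  | one => exact ⟨[], rfl⟩
  | mul_right x hx y hy ih =>
    obtain ⟨w, rfl⟩ := ih
    exact ⟨(⟨y, hy⟩, true) :: w, rfl⟩
  | mul_inv_cancel x hx y hy ih =>
    obtain ⟨w, rfl⟩ := ih
    exact ⟨(⟨y, hy⟩, false) :: w, rfl⟩

theorem cayleyGraph_dist_mul_letterValue_le (a : G) (l : S × Bool) :
    (cayleyGraph S).dist a (a * letterValue l) ≤ 1 := by
  obtain ⟨s, b⟩ := l
  cases b
  · rw [LabelledDigraph.dist_comm]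
    exact LabelledDigraph.dist_le_one_of_edge (l := s) _ (by simp [cayleyGraph, letterValue])
  · exact LabelledDigraph.dist_le_one_of_edge (l := s) _ rfl

theorem wordValue_mem_ball {w : List (S × Bool)} {r : ℕ} (h : w.length ≤ r) :
    wordValue w ∈ (cayleyGraph S).ball 1 r := by
  suffices (cayleyGraph S).dist 1 (wordValue w) ≤ w.length from this.trans (mod_cast h)
  clear h
  induction w with
  | nil => simp [wordValue, LabelledDigraph.dist_self]
  | cons l w ih =>
    refine (LabelledDigraph.dist_triangle _ _ (wordValue w) _).trans ?_
    simp only [List.length_cons, Nat.cast_add, Nat.cast_one]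
    exact add_le_add ih (cayleyGraph_dist_mul_letterValue_le _ _)

theorem exists_word_of_cayleyGraph_walk {a b : G} (p : (cayleyGraph S).underlying.Walk a b) :
    ∃ w : List (S × Bool), w.length = p.length ∧ a * wordValue w = b := by
  induction p with
  | nil => exact ⟨[], rfl, by simp [wordValue]⟩
  | @cons a c b hadj p ih =>
    obtain ⟨w, hw, hv⟩ := ih
    obtain ⟨-, ⟨s, hs⟩ | ⟨s, hs⟩⟩ := (SimpleGraph.fromRel_adj _ _ _).1 hadj
    -- Words are followed from their end, so the first edge of the walk becomes the last letter.
    · refine ⟨w ++ [(s, true)], by simp [hw], ?_⟩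
      have hs' : c = a * s := hs
      rw [wordValue_append, ← hv, hs']
      simp [wordValue, letterValue, mul_assoc]
    · refine ⟨w ++ [(s, false)], by simp [hw], ?_⟩
      have hs' : a = c * s := hs
      rw [wordValue_append, ← hv, hs']
      simp [wordValue, letterValue, mul_assoc]

theorem exists_word_of_mem_ball {a : G} {r : ℕ} (h : a ∈ (cayleyGraph S).ball 1 r) :
    ∃ w : List (S × Bool), w.length ≤ r ∧ wordValue w = a := by
  have h' : (cayleyGraph S).underlying.edist 1 a ≤ r := h
  obtain ⟨p, hp⟩ := SimpleGraph.exists_walk_of_edist_ne_top (ne_top_of_le_ne_top (by simp) h')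
  obtain ⟨w, hw, hv⟩ := exists_word_of_cayleyGraph_walk p
  refine ⟨w, ?_, by simpa using hv⟩
  rw [hw]
  rw [← hp] at h'
  exact_mod_cast h'

theorem finite_cayleyGraph_ball (S : Finset G) (r : ℕ) : ((cayleyGraph S).ball 1 r).Finite := by
  refine ((List.finite_length_le (S × Bool) r).image wordValue).subset fun a ha => ?_
  obtain ⟨w, hw, hv⟩ := exists_word_of_mem_ball ha
  exact ⟨w, hw, hv⟩

/-- Each letter has a unique edge at a vertex of the Cayley graph, so the arbitrary choice made by
`step` is forced inside a good ball. A word of length at most `r` never leaves that ball. -/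
theorem follow_eq_of_good {V : Type w₁} {Γ : LabelledDigraph S V} {x : V} {r : ℕ}
    {θ : (cayleyGraph S).ball 1 r ≃ Γ.ball x r}
    (h1 : ∀ a : (cayleyGraph S).ball 1 r, (a : G) = 1 → (θ a : V) = x)
    (h2 : ∀ (s : S) (a b : (cayleyGraph S).ball 1 r),
      (cayleyGraph S).Edge s a b ↔ Γ.Edge s (θ a) (θ b))
    {w : List (S × Bool)} (hw : w.length ≤ r) :
    Γ.follow w x = θ ⟨wordValue w, wordValue_mem_ball hw⟩ := by
  induction w with
  | nil => exact (h1 _ rfl).symm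
  | cons l w ih =>
    have hw' : w.length ≤ r := (Nat.le_succ _).trans hw
    have hmem : Γ.step l (Γ.follow w x) ∈ Γ.ball x r :=
      (Γ.dist_follow_le (l :: w) x).trans (by exact_mod_cast hw)
    obtain ⟨b, hb⟩ := θ.surjective ⟨_, hmem⟩
    have hb' : (θ b : V) = Γ.step l (Γ.follow w x) := congrArg Subtype.val hb
    have ih' := ih hw'
    set a : (cayleyGraph S).ball 1 r := ⟨wordValue w, wordValue_mem_ball hw'⟩ with ha
    set c : (cayleyGraph S).ball 1 r := ⟨wordValue (l :: w), wordValue_mem_ball hw⟩ with hc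
    have hca : (c : G) = a * letterValue l := rfl
    obtain ⟨s, _ | _⟩ := l
    · have hca' : (c : G) = a * (s : G)⁻¹ := hca
      have hspec := Γ.step_spec (l := (s, false)) (x := Γ.follow w x)
        ⟨θ c, by
          rw [ih']
          refine (h2 s c a).1 ?_
          change (a : G) = c * s
          rw [hca']; group⟩
      have hspec' : Γ.Edge s (θ b) (θ a) := by rw [hb', ← ih']; exact hspec
      have hab : (a : G) = b * s := (h2 s b a).2 hspec'
      have : b = c := Subtype.ext (by rw [hca', hab]; group)
      rw [← this, hb']; rfl
    · have hca' : (c : G) = a * (s : G) := hca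
      have hspec := Γ.step_spec (l := (s, true)) (x := Γ.follow w x)
        ⟨θ c, by
          rw [ih']
          exact (h2 s a c).1 hca'⟩
      have hspec' : Γ.Edge s (θ a) (θ b) := by rw [hb', ← ih']; exact hspec
      have hab : (b : G) = a * s := (h2 s a b).2 hspec'
      have : b = c := Subtype.ext (by rw [hca', hab])
      rw [← this, hb']; rfl

end Word

/-! ### Approximate actions from sofic approximations. -/

section ApproxAction

/-- Maps `act n x : G → V n` which, statistically, look like a free right action of `G` on the
graphs `Γ n` whose orbit maps describe the balls of `Γ n`. -/
structure IsApproxAction {G : Type u} [Group G] (U : Ultrafilter ℕ) {L : Type w₁}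
    {V : ℕ → Type w₂} [∀ n, Finite (V n)] (Γ : ∀ n, LabelledDigraph L (V n))
    (act : ∀ n, V n → G → V n) : Prop where
  act_mul : ∀ a b : G, ∀ᶠ p in statFilter U V,
    act p.1 (act p.1 p.2 a) b = act p.1 p.2 (a * b)
  act_one : ∀ᶠ p in statFilter U V, act p.1 p.2 1 = p.2
  act_inj : ∀ a b : G, ∀ᶠ p in statFilter U V, act p.1 p.2 a = act p.1 p.2 b → a = b
  dist_act_le : ∀ a : G, ∃ C : ℕ, ∀ n x, (Γ n).dist x (act n x a) ≤ C
  exists_of_dist_le : ∀ C : ℕ, ∃ F : Finset G, ∀ᶠ p in statFilter U V,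
    ∀ y, (Γ p.1).dist p.2 y ≤ C → ∃ a ∈ F, y = act p.1 p.2 a

theorem IsSoficApproximation.exists_isApproxAction {G : Type u} [Group G] {S : Finset G}
    (hS : Subgroup.closure (S : Set G) = ⊤) {U : Ultrafilter ℕ} {V : ℕ → Type w₁}
    [∀ n, Finite (V n)] [∀ n, Nonempty (V n)] {Γ : ∀ n, LabelledDigraph S (V n)}
    (hΓ : ∀ r : ℕ, Tendsto (fun n => uniformProb (goodVertices S (Γ n) r)) U (𝓝 1)) :
    ∃ act : ∀ n, V n → G → V n, IsApproxAction U Γ act := by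
  have hgood : ∀ r : ℕ, ∀ᶠ p in statFilter U V, p.2 ∈ goodVertices S (Γ p.1) r := by
    intro r
    rw [eventually_statFilter]
    have := (hΓ r).const_sub 1
    rw [sub_self] at this
    refine this.congr fun n => ?_
    rw [← uniformProb_compl]; rfl
  choose w hw using exists_wordValue_eq hS
  refine ⟨fun n x g => (Γ n).follow (w g) x, ?_, ?_, ?_, ?_, ?_⟩
  · intro a b
    filter_upwards [hgood (max (w b ++ w a).length (w (a * b)).length)] with p hp
    obtain ⟨θ, h1, h2⟩ := hp
    rw [← LabelledDigraph.follow_append,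
      follow_eq_of_good h1 h2 (le_max_left _ _), follow_eq_of_good h1 h2 (le_max_right _ _)]
    congr 3
    rw [wordValue_append, hw, hw, hw]
  · filter_upwards [hgood (w 1).length] with p hp
    obtain ⟨θ, h1, h2⟩ := hp
    rw [follow_eq_of_good h1 h2 le_rfl]
    exact h1 _ (hw 1)
  · intro a b
    filter_upwards [hgood (max (w a).length (w b).length)] with p hp hab
    obtain ⟨θ, h1, h2⟩ := hp
    rw [follow_eq_of_good h1 h2 (le_max_left _ _),
      follow_eq_of_good h1 h2 (le_max_right _ _)] at hab
    have : wordValue (w a) = wordValue (w b) :=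
      congrArg Subtype.val (θ.injective (Subtype.ext hab))
    rwa [hw, hw] at this
  · exact fun a => ⟨(w a).length, fun n x => (Γ n).dist_follow_le (w a) x⟩
  · intro C
    have hfin := finite_cayleyGraph_ball S C
    refine ⟨hfin.toFinset, ?_⟩
    -- The words fixed for the elements of the `C`-ball may be longer than `C`; the radius `R`
    -- accommodates them, so that both words can be compared in one good ball.
    set R := max C (hfin.toFinset.sup fun a => (w a).length) with hR
    filter_upwards [hgood C, hgood R] with p hp hp' y hy
    obtain ⟨θ, h1, h2⟩ := hp
    obtain ⟨θ', h1', h2'⟩ := hp'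
    obtain ⟨a, ha⟩ := θ.surjective ⟨y, hy⟩
    have ha' : (a : G) ∈ hfin.toFinset := hfin.mem_toFinset.2 a.2
    refine ⟨a, ha', ?_⟩
    obtain ⟨w', hlen, hval⟩ := exists_word_of_mem_ball a.2
    have hlen' : (w (a : G)).length ≤ R :=
      (Finset.le_sup (f := fun a => (w a).length) ha').trans (le_max_right _ _)
    calc y = θ a := (congrArg Subtype.val ha).symm
      _ = (Γ p.1).follow w' p.2 := by
        rw [follow_eq_of_good h1 h2 hlen]; congr 2; exact Subtype.ext hval.symm
      _ = (Γ p.1).follow (w (a : G)) p.2 := by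
        rw [follow_eq_of_good h1' h2' (hlen.trans (le_max_left _ _)),
          follow_eq_of_good h1' h2' hlen']
        congr 3
        rw [hval, hw]

end ApproxAction

/-! ### Weak ultralimits of empirical laws. -/

section Ultralimit

theorem exists_empirical_measure {X : Type w₁} [Finite X] [Nonempty X] {K : Type w₂}
    [MeasurableSpace K] (F : X → K) :
    ∃ ν : ProbabilityMeasure K, ∀ s, MeasurableSet s →
      (ν : Measure K).real s = uniformProb {x | F x ∈ s} := by
  classical
  have := Fintype.ofFinite X
  have hcard : (Nat.card X : ℝ≥0∞) ≠ 0 := by exact_mod_cast Nat.card_pos.ne'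
  have key : ∀ s, MeasurableSet s →
      ((Nat.card X : ℝ≥0∞)⁻¹ • ∑ x, Measure.dirac (F x) : Measure K) s
        = (Nat.card X : ℝ≥0∞)⁻¹ * ({x | F x ∈ s}.ncard : ℝ≥0∞) := by
    intro s hs
    simp only [Measure.smul_apply, Measure.finsetSum_apply, smul_eq_mul,
      Measure.dirac_apply' _ hs, Set.indicator_apply, Pi.one_apply]
    rw [Finset.sum_boole, Set.ncard_eq_toFinset_card']
    congr 3
    ext x; simp
  refine ⟨⟨(Nat.card X : ℝ≥0∞)⁻¹ • ∑ x, Measure.dirac (F x), ⟨?_⟩⟩, fun s hs => ?_⟩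
  · rw [key _ MeasurableSet.univ]
    have : ({x | F x ∈ (Set.univ : Set K)}.ncard) = Nat.card X := by simp [Set.ncard_univ]
    rw [this]
    exact ENNReal.inv_mul_cancel hcard (ENNReal.natCast_ne_top _)
  · rw [Measure.real, ProbabilityMeasure.coe_mk, key _ hs, uniformProb]
    simp [ENNReal.toReal_mul, div_eq_inv_mul]

variable {ι : Type w₁} {D : Type w₂} {V : ℕ → Type w₃} {U : Ultrafilter ℕ}

/-- The coding of the points of a discrete space by their indicator functions. -/
noncomputable def indicatorCode (d : D) : D → Bool := fun d' => open Classical in decide (d = d')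

/-- This places the discrete space `D` in a compact space, where limits of laws exist without any
tightness. -/
theorem isEmbedding_indicatorCode [TopologicalSpace D] [DiscreteTopology D] :
    IsEmbedding (indicatorCode : D → D → Bool) := by
  have hinj : Function.Injective (indicatorCode : D → D → Bool) := by
    intro a b hab
    have := congrFun hab b
    simpa [indicatorCode] using this
  refine ⟨⟨?_⟩, hinj⟩
  refine le_antisymm (continuous_iff_le_induced.1 continuous_of_discreteTopology) ?_
  intro s _
  refine ⟨⋃ d ∈ s, {φ | φ d = true}, ?_, ?_⟩
  · refine isOpen_biUnion fun d _ => ?_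
    have h : Continuous fun φ : D → Bool => φ d := continuous_apply d
    exact (isOpen_discrete ({true} : Set Bool)).preimage h
  · ext a
    simp [indicatorCode]

/-- Probability measures on a compact space form a weakly compact space, so the empirical laws
converge along `U`; the bound on open sets is the portmanteau theorem. -/
theorem exists_weak_ultralimit [∀ n, Finite (V n)] [∀ n, Nonempty (V n)] {K : Type w₄}
    [TopologicalSpace K] [CompactSpace K] [T2Space K] [HasOuterApproxClosed K]
    [MeasurableSpace K] [BorelSpace K] (U : Ultrafilter ℕ) (F : ∀ n, V n → K) :
    ∃ P : Measure K, IsProbabilityMeasure P ∧ ∀ O : Set K, IsOpen O →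
      P O ≤ (U : Filter ℕ).liminf fun n => ENNReal.ofReal (uniformProb {x | F n x ∈ O}) := by
  choose ν hν using fun n => exists_empirical_measure (F n)
  obtain ⟨P, -, hP⟩ := isCompact_univ.ultrafilter_le_nhds' (U.map ν) Filter.univ_mem
  have hP' : Tendsto ν U (𝓝 P) := hP
  refine ⟨P, inferInstance, fun O hO => ?_⟩
  refine (ProbabilityMeasure.le_liminf_measure_open_of_tendsto hP' hO).trans (le_of_eq ?_)
  congr 1
  ext n
  rw [← hν n O hO.measurableSet]
  simp

variable [Countable ι] [Countable D] [TopologicalSpace D] [DiscreteTopology D]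
  [MeasurableSpace D] [BorelSpace D] [∀ n, Finite (V n)] [∀ n, Nonempty (V n)]

/-- A coordinatewise tight family of empirical laws on a product of discrete spaces has a weak
ultralimit. -/
theorem exists_ultralimit_measure (f : ∀ n, V n → ι → D)
    (hf : ∀ i, StatTight U fun p : Σ n, V n => f p.1 p.2 i) :
    ∃ P : Measure (ι → D), IsProbabilityMeasure P ∧ ∀ E, IsClopen E →
      Tendsto (fun n => uniformProb {x | f n x ∈ E}) U (𝓝 (P.real E)) := by
  set c : (ι → D) → ι → D → Bool := Pi.map fun _ => indicatorCode with hc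
  have hemb : IsEmbedding c := IsEmbedding.piMap fun _ => isEmbedding_indicatorCode
  have : DiscreteMeasurableSpace D := ⟨fun s => (isOpen_discrete s).measurableSet⟩
  have hmeas : MeasurableEmbedding c := hemb.continuous.measurable.measurableEmbedding hemb.injective
  obtain ⟨P', _, hopen⟩ := exists_weak_ultralimit U fun n x => c (f n x)
  -- Tightness is used here: up to `ε` the `i`th coordinate stays in a finite, hence closed, set of
  -- codes, so the limit gives no mass to the points added by the compactification.
  have hcoord : ∀ i, ∀ᵐ φ ∂P', φ i ∈ Set.range
      (indicatorCode : D → D → Bool) := by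
    intro i
    rw [ae_iff, ← nonpos_iff_eq_zero]
    refine ENNReal.le_of_forall_pos_le_add fun ε hε _ => ?_
    obtain ⟨F, hF⟩ := hf i ε (by exact_mod_cast hε)
    have hO : IsOpen {φ : ι → D → Bool | φ i ∉ indicatorCode '' (F : Set D)} := by
      have h1 : IsClosed (indicatorCode '' (F : Set D)) :=
        (F.finite_toSet.image _).isClosed
      have h2 : Continuous fun φ : ι → D → Bool => φ i := continuous_apply i
      exact h1.isOpen_compl.preimage h2
    refine (measure_mono ?_).trans ((hopen _ hO).trans ?_)
    · rintro φ hφ ⟨d, -, hd⟩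
      exact hφ ⟨d, hd⟩
    · refine liminf_le_of_frequently_le' (Eventually.frequently ?_)
      filter_upwards [hF] with n hn
      rw [zero_add, ← ENNReal.ofReal_coe_nnreal]
      refine ENNReal.ofReal_le_ofReal ((uniformProb_mono ?_).trans hn)
      rintro x hx ⟨d, hd, hxd⟩
      exact hx ⟨d, hd, by rw [← hxd]; rfl⟩
  have hrange : ∀ᵐ φ ∂P', φ ∈ Set.range c := by
    filter_upwards [ae_all_iff.2 hcoord] with φ hφ
    choose a ha using hφ
    exact ⟨a, funext ha⟩
  have hcomap : ∀ O : Set (ι → D → Bool),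
      P'.comap c (c ⁻¹' O) = P' O := by
    intro O
    rw [hmeas.comap_apply, Set.image_preimage_eq_inter_range]
    refine measure_congr ?_
    filter_upwards [hrange] with φ hφ
    exact propext ⟨fun h => h.1, fun h => ⟨h, hφ⟩⟩
  have hprob : IsProbabilityMeasure (P'.comap c) :=
    ⟨by rw [← Set.preimage_univ, hcomap, measure_univ]⟩
  have hlower : ∀ E : Set (ι → D), IsOpen E → ∀ a < (P'.comap c).real E,
      ∀ᶠ n in (U : Filter ℕ), a < uniformProb {x | f n x ∈ E} := by
    intro E hE a ha
    rcases lt_or_ge a 0 with h0 | h0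
    · exact Eventually.of_forall fun n => h0.trans_le (uniformProb_nonneg _)
    obtain ⟨O, hO, rfl⟩ := hemb.isOpen_iff.1 hE
    rw [Measure.real, hcomap, ← ENNReal.ofReal_lt_iff_lt_toReal h0 (measure_ne_top _ _)] at ha
    filter_upwards [eventually_lt_of_lt_liminf (ha.trans_le (hopen O hO))] with n hn
    exact (ENNReal.ofReal_lt_ofReal_iff_of_nonneg h0).1 hn
  -- For a clopen set the lower bound applies to the set and to its complement, which gives
  -- convergence.
  refine ⟨P'.comap c, hprob, fun E hE => tendsto_order.2
    ⟨hlower E hE.isOpen, fun b hb => ?_⟩⟩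
  have := hlower Eᶜ hE.isClosed.isOpen_compl (1 - b) (by
    rw [measureReal_compl hE.isOpen.measurableSet]; simp; linarith)
  filter_upwards [this] with n hn
  have h2 := uniformProb_compl {x | f n x ∈ E}
  have h3 : {x | f n x ∈ Eᶜ} = {x | f n x ∈ E}ᶜ := rfl
  rw [h3, h2] at hn
  linarith

end Ultralimit

/-! ### The space of pairs of maps and its two actions. -/

section CouplingSpace

set_option linter.unusedSectionVars false

/-- The space of pairs of maps `α : G → H`, `β : H → G`. -/
def CouplingSpace (G : Type u) (H : Type v) : Type (max u v) := (G → H) × (H → G)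

namespace CouplingSpace

variable {G : Type u} {H : Type v}

/-- The pair of two maps. -/
def mk (α : G → H) (β : H → G) : CouplingSpace G H := (α, β)

/-- The first map of a pair. -/
def fst (ω : CouplingSpace G H) : G → H := Prod.fst ω

/-- The second map of a pair. -/
def snd (ω : CouplingSpace G H) : H → G := Prod.snd ω

section Action

variable [Group G] [Group H]

/-- A pair is thought of as seen from base points `x`, `z`, with `u (x·g) = z·α g` and `s (z·h) =
x·β h`. The action of `a : G` moves `x` to `x·a⁻¹`, and that of `b : H` moves `z` to `z·b⁻¹`. Each
group left-translates the values of one of the maps, so both actions are free at every point. -/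
instance : MulAction G (CouplingSpace G H) where
  smul a ω := mk (fun g => ω.fst (a⁻¹ * g)) (fun h => a * ω.snd h)
  one_smul ω := Prod.ext (funext fun g => congrArg ω.fst (by group))
    (funext fun h => one_mul (ω.snd h))
  mul_smul a b ω := Prod.ext (funext fun g => congrArg ω.fst (by group))
    (funext fun h => mul_assoc a b (ω.snd h))

instance : MulAction H (CouplingSpace G H) where
  smul b ω := mk (fun g => b * ω.fst g) (fun h => ω.snd (b⁻¹ * h))
  one_smul ω := Prod.ext (funext fun g => one_mul (ω.fst g))
    (funext fun h => congrArg ω.snd (by group))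
  mul_smul a b ω := Prod.ext (funext fun g => mul_assoc a b (ω.fst g))
    (funext fun h => congrArg ω.snd (by group))

theorem left_smul_fst (a : G) (ω : CouplingSpace G H) (g : G) :
    (a • ω).fst g = ω.fst (a⁻¹ * g) := rfl

theorem left_smul_snd (a : G) (ω : CouplingSpace G H) (h : H) :
    (a • ω).snd h = a * ω.snd h := rfl

theorem right_smul_fst (b : H) (ω : CouplingSpace G H) (g : G) :
    (b • ω).fst g = b * ω.fst g := rfl

theorem right_smul_snd (b : H) (ω : CouplingSpace G H) (h : H) :
    (b • ω).snd h = ω.snd (b⁻¹ * h) := rfl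

instance : SMulCommClass G H (CouplingSpace G H) := ⟨fun _ _ _ => rfl⟩

/-- The action of `g⁻¹`, followed by the translation by the element of `H` that makes the first
map send `1` to `1`. -/
def reroot (g : G) (ω : CouplingSpace G H) : CouplingSpace G H := (ω.fst g)⁻¹ • g⁻¹ • ω

theorem reroot_fst (g : G) (ω : CouplingSpace G H) (g' : G) :
    (reroot g ω).fst g' = (ω.fst g)⁻¹ * ω.fst (g * g') := by
  simp [reroot, left_smul_fst, right_smul_fst]

theorem reroot_snd (g : G) (ω : CouplingSpace G H) (h : H) :
    (reroot g ω).snd h = g⁻¹ * ω.snd (ω.fst g * h) := by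
  simp [reroot, left_smul_snd, right_smul_snd]

end Action

section Topology

variable [TopologicalSpace G] [TopologicalSpace H] [MeasurableSpace G] [MeasurableSpace H]

instance : TopologicalSpace (CouplingSpace G H) :=
  inferInstanceAs (TopologicalSpace ((G → H) × (H → G)))

instance : MeasurableSpace (CouplingSpace G H) :=
  inferInstanceAs (MeasurableSpace ((G → H) × (H → G)))

theorem continuous_fst_apply (g : G) : Continuous fun ω : CouplingSpace G H => ω.fst g :=
  (continuous_apply g).comp (continuous_fst (X := G → H) (Y := H → G))

theorem continuous_snd_apply (h : H) : Continuous fun ω : CouplingSpace G H => ω.snd h :=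
  (continuous_apply h).comp (continuous_snd (X := G → H) (Y := H → G))

theorem continuous_iff {X : Type*} [TopologicalSpace X] {f : X → CouplingSpace G H} :
    Continuous f ↔ (∀ g, Continuous fun x => (f x).fst g) ∧ ∀ h, Continuous fun x => (f x).snd h :=
  ⟨fun hf => ⟨fun g => (continuous_fst_apply g).comp hf, fun h => (continuous_snd_apply h).comp hf⟩,
    fun hf => Continuous.prodMk (continuous_pi hf.1) (continuous_pi hf.2)⟩

theorem measurable_fst_apply (g : G) : Measurable fun ω : CouplingSpace G H => ω.fst g :=
  (measurable_pi_apply g).comp (measurable_fst (α := G → H) (β := H → G))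

theorem measurable_snd_apply (h : H) : Measurable fun ω : CouplingSpace G H => ω.snd h :=
  (measurable_pi_apply h).comp (measurable_snd (α := G → H) (β := H → G))

theorem measurable_iff {X : Type*} {mX : MeasurableSpace X} {f : X → CouplingSpace G H} :
    Measurable f ↔ (∀ g, Measurable fun x => (f x).fst g) ∧ ∀ h, Measurable fun x => (f x).snd h :=
  ⟨fun hf => ⟨fun g => (measurable_fst_apply g).comp hf, fun h => (measurable_snd_apply h).comp hf⟩,
    fun hf => Measurable.prodMk (measurable_pi_iff.2 hf.1) (measurable_pi_iff.2 hf.2)⟩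

variable [DiscreteTopology G] [DiscreteTopology H] [BorelSpace G] [BorelSpace H]
  [Countable G] [Countable H]

instance : BorelSpace (CouplingSpace G H) := inferInstanceAs (BorelSpace ((G → H) × (H → G)))

instance : StandardBorelSpace (CouplingSpace G H) :=
  have : DiscreteMeasurableSpace G := ⟨fun s => (isOpen_discrete s).measurableSet⟩
  have : DiscreteMeasurableSpace H := ⟨fun s => (isOpen_discrete s).measurableSet⟩
  inferInstanceAs (StandardBorelSpace ((G → H) × (H → G)))

/-- The inner value `ω.fst g` is locally constant, so near each point the map is a single
coordinate. -/
theorem continuous_snd_comp [Group H] (g : G) (h : H) :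
    Continuous fun ω : CouplingSpace G H => ω.snd (ω.fst g * h) := by
  refine continuous_iff_continuousAt.2 fun ω => ?_
  refine (continuous_snd_apply (ω.fst g * h)).continuousAt.congr ?_
  have h1 : ∀ᶠ ω' in 𝓝 ω, ω'.fst g = ω.fst g :=
    ((isOpen_discrete {ω.fst g}).preimage (continuous_fst_apply g)).mem_nhds rfl
  filter_upwards [h1] with ω' hω'
  rw [hω']

theorem measurableSet_fst_eq (g : G) (c : H) :
    MeasurableSet {ω : CouplingSpace G H | ω.fst g = c} :=
  measurable_fst_apply g ((isOpen_discrete {c}).measurableSet)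

theorem measurableSet_snd_eq (h : H) (c : G) :
    MeasurableSet {ω : CouplingSpace G H | ω.snd h = c} :=
  measurable_snd_apply h ((isOpen_discrete {c}).measurableSet)

section Continuity

variable [Group G] [Group H]

theorem continuous_left_smul (a : G) : Continuous fun ω : CouplingSpace G H => a • ω :=
  continuous_iff.2 ⟨fun g => continuous_fst_apply (a⁻¹ * g), fun h =>
    (continuous_of_discreteTopology (f := fun c : G => a * c)).comp (continuous_snd_apply h)⟩

theorem continuous_right_smul (b : H) : Continuous fun ω : CouplingSpace G H => b • ω :=
  continuous_iff.2 ⟨fun g => (continuous_of_discreteTopology (f := fun c : H => b * c)).comp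
    (continuous_fst_apply g), fun h => continuous_snd_apply (b⁻¹ * h)⟩

theorem continuous_reroot (g : G) : Continuous (reroot g : CouplingSpace G H → _) := by
  refine continuous_iff.2 ⟨fun g' => ?_, fun h => ?_⟩
  · simp only [reroot_fst]
    exact (continuous_of_discreteTopology (f := fun c : H × H => c.1⁻¹ * c.2)).comp
      ((continuous_fst_apply g).prodMk (continuous_fst_apply (g * g')))
  · simp only [reroot_snd]
    exact (continuous_of_discreteTopology (f := fun c : G => g⁻¹ * c)).comp
      (continuous_snd_comp g h)

end Continuity

end Topology

end CouplingSpace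

end CouplingSpace

/-! ### From an invariant probability measure to a coupling. -/

/-- An orbit equivalence coupling needs literally equal domains, while the two natural ones agree
only almost everywhere; this permits exchanging one for the other. -/
theorem isFundamentalDomain_congr {G : Type u} {X : Type v} [Group G] [MulAction G X]
    [MeasurableSpace X] {μ : Measure X} [MeasurableConstSMul G X] [SMulInvariantMeasure G X μ]
    [Countable G] {s t : Set X} (hs : IsFundamentalDomain G s μ) (hst : s =ᵐ[μ] t) :
    IsFundamentalDomain G t μ := by
  refine ⟨hs.nullMeasurableSet.congr hst, ?_, ?_⟩
  · have h1 : ∀ g : G, ∀ᵐ x ∂μ, g • x ∈ s ↔ g • x ∈ t := fun g =>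
      (measurePreserving_smul g μ).quasiMeasurePreserving.ae
        (hst.mono fun x hx => (iff_of_eq hx : x ∈ s ↔ x ∈ t))
    filter_upwards [hs.ae_covers, ae_all_iff.2 h1] with x ⟨g, hg⟩ hx
    exact ⟨g, (hx g).1 hg⟩
  · intro a b hab
    exact (hs.aedisjoint hab).congr ((smul_set_ae_eq a).2 hst).symm ((smul_set_ae_eq b).2 hst).symm

namespace CouplingSpace

set_option linter.unusedSectionVars false

section CouplingMeasure

variable {G : Type u} {H : Type v} [TopologicalSpace G] [TopologicalSpace H] [MeasurableSpace G]
  [MeasurableSpace H] [DiscreteTopology G] [DiscreteTopology H] [BorelSpace G] [BorelSpace H]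
  [Countable G] [Countable H] [Group G] [Group H]

/-- The sum of the translates of a measure by the elements of `H`. -/
noncomputable def sumTranslates (P : Measure (CouplingSpace G H)) : Measure (CouplingSpace G H) :=
  Measure.sum fun h : H => P.map fun ω => h • ω

variable {P : Measure (CouplingSpace G H)}

theorem sumTranslates_apply {E : Set (CouplingSpace G H)} (hE : MeasurableSet E) :
    sumTranslates P E = ∑' h : H, P {ω | h • ω ∈ E} := by
  rw [sumTranslates, Measure.sum_apply _ hE]
  refine tsum_congr fun h => ?_
  rw [Measure.map_apply (continuous_right_smul h).measurable hE]
  rfl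

theorem measurePreserving_right (b : H) :
    MeasurePreserving (fun ω : CouplingSpace G H => b • ω) (sumTranslates P)
      (sumTranslates P) := by
  refine ⟨(continuous_right_smul b).measurable, Measure.ext fun E hE => ?_⟩
  rw [Measure.map_apply (continuous_right_smul b).measurable hE,
    sumTranslates_apply ((continuous_right_smul b).measurable hE), sumTranslates_apply hE,
    ← (Equiv.mulLeft b).tsum_eq fun h : H => P {ω | h • ω ∈ E}]
  refine tsum_congr fun h => ?_
  simp only [Equiv.coe_mulLeft, mul_smul, Set.mem_preimage]

/-- The measure of `E` is the `P`-integral of the number of `h` with `h • ω ∈ E`, which depends only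
on the `H`-orbit of `ω`. On orbits, `a` acts as `reroot a⁻¹`, which preserves `P`. -/
theorem measurePreserving_left (hP : ∀ g : G, P.map (reroot g) = P) (a : G) :
    MeasurePreserving (fun ω : CouplingSpace G H => a • ω) (sumTranslates P)
      (sumTranslates P) := by
  have hmeas : Measurable fun ω : CouplingSpace G H => a • ω := (continuous_left_smul a).measurable
  refine ⟨hmeas, Measure.ext fun E hE => ?_⟩
  have hr : ∀ h : H, Measurable fun ω : CouplingSpace G H => h • ω :=
    fun h => (continuous_right_smul h).measurable
  have hind : ∀ h : H, Measurable fun ω : CouplingSpace G H =>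
      E.indicator (fun _ => (1 : ℝ≥0∞)) (h • ω) :=
    fun h => (measurable_const.indicator hE).comp (hr h)
  have key : ∀ (f : CouplingSpace G H → CouplingSpace G H), Measurable f →
      ∑' h : H, P {ω | h • f ω ∈ E} =
        ∫⁻ ω, ∑' h : H, E.indicator (fun _ => (1 : ℝ≥0∞)) (h • f ω) ∂P := by
    intro f hf
    refine Eq.trans ?_ (lintegral_tsum fun h => ((hind h).comp hf).aemeasurable).symm
    refine tsum_congr fun h => ?_
    exact (lintegral_indicator_one (((hr h).comp hf) hE)).symm
  rw [Measure.map_apply hmeas hE, sumTranslates_apply (hmeas hE), sumTranslates_apply hE]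
  have h1 : ∀ h : H, {ω : CouplingSpace G H | h • ω ∈ (fun ω => a • ω) ⁻¹' E} =
      {ω | h • (a • ω) ∈ E} := fun h => rfl
  simp_rw [h1]
  rw [key _ hmeas, show ∑' h : H, P {ω | h • ω ∈ E} = _ from key id measurable_id]
  conv_rhs => rw [← hP a⁻¹]
  refine Eq.trans ?_ (lintegral_map (Measurable.tsum fun h => hind h)
    (continuous_reroot _).measurable).symm
  refine lintegral_congr fun ω => ?_
  rw [← (Equiv.mulRight (ω.fst a⁻¹)⁻¹).tsum_eq fun h : H =>
    E.indicator (fun _ => (1 : ℝ≥0∞)) (h • a • ω)]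
  refine tsum_congr fun h => ?_
  simp [reroot, mul_smul]

theorem existsUnique_smul_mem_left (ω : CouplingSpace G H) :
    ∃! a : G, a • ω ∈ {ω : CouplingSpace G H | ω.snd 1 = 1} :=
  ⟨(ω.snd 1)⁻¹, by simp [left_smul_snd], fun a ha => eq_inv_of_mul_eq_one_left ha⟩

theorem existsUnique_smul_mem_right (ω : CouplingSpace G H) :
    ∃! b : H, b • ω ∈ {ω : CouplingSpace G H | ω.fst 1 = 1} :=
  ⟨(ω.fst 1)⁻¹, by simp [right_smul_fst], fun b hb => eq_inv_of_mul_eq_one_left hb⟩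

theorem sumTranslates_snd_eq_one :
    sumTranslates P {ω | ω.snd 1 = 1} = ∑' h : H, P {ω | ω.snd h = 1} := by
  rw [sumTranslates_apply (measurableSet_snd_eq 1 1), ← (Equiv.inv H).tsum_eq]
  refine tsum_congr fun h => ?_
  simp [right_smul_snd]

/-- As `fst 1 = 1` almost surely for `P`, only the translate by `b` charges this set. -/
theorem sumTranslates_fst_eq [IsProbabilityMeasure P] (hP1 : ∀ᵐ ω ∂P, ω.fst 1 = 1) (b : H) :
    sumTranslates P {ω | ω.fst 1 = b} = 1 := by
  rw [sumTranslates_apply (measurableSet_fst_eq 1 b), tsum_eq_single b]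
  · refine (prob_compl_eq_zero_iff
      ((continuous_right_smul b).measurable (measurableSet_fst_eq 1 b))).1 (mem_ae_iff.1 ?_)
    filter_upwards [hP1] with ω hω
    simp [right_smul_fst, hω]
  · intro h hne
    refine measure_eq_zero_iff_ae_notMem.2 ?_
    filter_upwards [hP1] with ω hω
    simp [right_smul_fst, hω, hne]

theorem sigmaFinite_sumTranslates [IsProbabilityMeasure P] (hP1 : ∀ᵐ ω ∂P, ω.fst 1 = 1) :
    SigmaFinite (sumTranslates P) := by
  refine Measure.sigmaFinite_of_countable
    (S := Set.range fun b : H => {ω : CouplingSpace G H | ω.fst 1 = b})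
    (Set.countable_range _) ?_ ?_
  · rintro _ ⟨b, rfl⟩
    rw [sumTranslates_fst_eq hP1]
    exact ENNReal.one_lt_top
  · ext ω; simp

/-- An invariant random map yields a coupling; the flag `oe` asks for equal fundamental domains. -/
theorem exists_coupling [IsProbabilityMeasure P] (hP1 : ∀ᵐ ω ∂P, ω.fst 1 = 1)
    (hP : ∀ g : G, P.map (reroot g) = P) (hfin : ∑' h : H, P {ω | ω.snd h = 1} < ∞)
    {oe : Prop} (hoe : oe → (∀ᵐ ω ∂P, ω.snd 1 = 1) ∧ ∀ h : H, h ≠ 1 → P {ω | ω.snd h = 1} = 0) :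
    ∃ c : MECoupling G H, c.covolumeRatio = ∑' h : H, P {ω | ω.snd h = 1} ∧
      ((∃ F : Finset H, ∀ h ∉ F, P {ω | ω.snd h = 1} = 0) → c.CoboundedGToH) ∧
      ((∃ F : Finset G, ∀ᵐ ω ∂P, ω.snd 1 ∈ F) → c.CoboundedHToG) ∧ (oe → c.IsOE) := by
  classical
  set XG : Set (CouplingSpace G H) := {ω | ω.snd 1 = 1} with hXG
  set XH : Set (CouplingSpace G H) := {ω | ω.fst 1 = 1} with hXH
  have hXGm : MeasurableSet XG := measurableSet_snd_eq 1 1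
  have hXHm : MeasurableSet XH := measurableSet_fst_eq 1 1
  have : MeasurableConstSMul G (CouplingSpace G H) := ⟨fun a => (continuous_left_smul a).measurable⟩
  have : SMulInvariantMeasure G (CouplingSpace G H) (sumTranslates P) :=
    ⟨fun a _ hs => (measurePreserving_left hP a).measure_preimage hs.nullMeasurableSet⟩
  have := sigmaFinite_sumTranslates hP1
  have hdG : IsFundamentalDomain G XG (sumTranslates P) :=
    IsFundamentalDomain.mk' hXGm.nullMeasurableSet existsUnique_smul_mem_left
  have hdH : IsFundamentalDomain H XH (sumTranslates P) :=
    IsFundamentalDomain.mk' hXHm.nullMeasurableSet existsUnique_smul_mem_right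
  have hnull : ∀ E : Set (CouplingSpace G H), MeasurableSet E →
      (∀ h : H, ∀ᵐ ω ∂P, h • ω ∉ E) → sumTranslates P E = 0 := by
    intro E hE h
    rw [sumTranslates_apply hE]
    exact ENNReal.tsum_eq_zero.2 fun h' => measure_eq_zero_iff_ae_notMem.2 (h h')
  have hae : oe → XG =ᵐ[sumTranslates P] XH := by
    intro ho
    obtain ⟨ho1, ho2⟩ := hoe ho
    refine ae_eq_set.2 ⟨hnull _ (hXGm.diff hXHm) fun h => ?_,
      hnull _ (hXHm.diff hXGm) fun h => ?_⟩
    · rcases eq_or_ne h 1 with rfl | hne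
      · filter_upwards [hP1] with ω hω h'
        exact h'.2 (by simpa [hXH] using hω)
      · filter_upwards [measure_eq_zero_iff_ae_notMem.1 (ho2 h⁻¹ (by simpa using hne))] with ω hω h'
        exact hω (by simpa [hXG, right_smul_snd] using h'.1)
    · filter_upwards [hP1, ho1] with ω hω hω' h'
      have h1 : h * ω.fst 1 = 1 := h'.1
      rw [hω, mul_one] at h1
      subst h1
      exact h'.2 (by simpa [hXG] using hω')
  -- `Y` is the domain of `G` used in the coupling: `XG` in general, replaced by the almost equal
  -- `XH` when `oe` holds.
  obtain ⟨Y, hYm, hY, hYoe⟩ : ∃ Y, MeasurableSet Y ∧ Y =ᵐ[sumTranslates P] XG ∧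
      (oe → Y = XH) := by
    by_cases ho : oe
    · exact ⟨XH, hXHm, (hae ho).symm, fun _ => rfl⟩
    · exact ⟨XG, hXGm, ae_eq_refl _, fun h => absurd h ho⟩
  have hμXH : sumTranslates P XH = 1 := sumTranslates_fst_eq hP1 1
  have hμXG : sumTranslates P Y = ∑' h : H, P {ω | ω.snd h = 1} := by
    rw [measure_congr hY, sumTranslates_snd_eq_one]
  refine ⟨{ Ω := CouplingSpace G H
            μ := sumTranslates P
            measurePreservingG := measurePreserving_left hP
            measurePreservingH := measurePreserving_right
            freeG := fun g ω h => ?_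
            freeH := fun h ω h' => ?_
            XG := Y
            XH := XH
            measurableSetXG := hYm
            measurableSetXH := hXHm
            fundamentalDomainXG := isFundamentalDomain_congr hdG hY.symm
            fundamentalDomainXH := hdH
            measureXG := hμXG.trans_lt hfin
            measureXH := hμXH }, ?_, ?_, ?_, ?_⟩
  · have h2 : g * ω.snd 1 = ω.snd 1 := congrFun (congrArg snd h) 1
    simpa using h2
  · have h2 : h * ω.fst 1 = ω.fst 1 := congrFun (congrArg fst h') 1
    simpa using h2
  · change sumTranslates P Y / sumTranslates P XH = _
    rw [hμXG, hμXH, div_one]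
  · rintro ⟨F, hF⟩
    -- The translate of `P` by `h` meets `XG` where `ω.snd h⁻¹ = 1`, whence the inverses.
    refine ⟨F.image (·⁻¹), ?_⟩
    have hsm : ∀ b : H, b • XH = {ω | ω.fst 1 = b} := by
      intro b
      ext ω
      rw [Set.mem_smul_set_iff_inv_smul_mem]
      simp only [hXH, Set.mem_ofPred_eq, right_smul_fst, inv_mul_eq_one]
      exact eq_comm
    suffices sumTranslates P (XG \ ⋃ h ∈ F.image (·⁻¹), h • XH) = 0 from
      (measure_congr (hY.diff (ae_eq_refl _))).trans this
    simp only [hsm]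
    refine hnull _ (hXGm.diff (Finset.measurableSet_biUnion _ fun b _ =>
      measurableSet_fst_eq 1 b)) fun h => ?_
    by_cases hh : h⁻¹ ∈ F
    · filter_upwards [hP1] with ω hω h'
      refine h'.2 (Set.mem_iUnion₂.2 ⟨h, Finset.mem_image.2 ⟨_, hh, inv_inv h⟩, ?_⟩)
      simp [right_smul_fst, hω]
    · filter_upwards [measure_eq_zero_iff_ae_notMem.1 (hF _ hh)] with ω hω h'
      exact hω (by simpa [hXG, right_smul_snd] using h'.1)
  · rintro ⟨F, hF⟩
    refine ⟨F, ?_⟩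
    have h1 : (⋃ g ∈ F, g • Y) =ᵐ[sumTranslates P] ⋃ g ∈ F, g • XG :=
      Filter.EventuallyEq.countable_bUnion F.countable_toSet fun g _ => (smul_set_ae_eq g).2 hY
    suffices sumTranslates P (XH \ ⋃ g ∈ F, g • XG) = 0 from
      (measure_congr ((ae_eq_refl _).diff h1)).trans this
    have hsm : ∀ a : G, a • XG = {ω | ω.snd 1 = a} := by
      intro a
      ext ω
      rw [Set.mem_smul_set_iff_inv_smul_mem]
      simp only [hXG, Set.mem_ofPred_eq, left_smul_snd, inv_mul_eq_one]
      exact eq_comm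
    simp only [hsm]
    refine hnull _ (hXHm.diff (Finset.measurableSet_biUnion _ fun b _ =>
      measurableSet_snd_eq 1 b)) fun h => ?_
    filter_upwards [hP1, hF] with ω hω hω' h'
    have h2 : h * ω.fst 1 = 1 := h'.1
    rw [hω, mul_one] at h2
    subst h2
    refine h'.2 (Set.mem_iUnion₂.2 ⟨_, hω', ?_⟩)
    simp
  · intro ho
    exact hYoe ho

end CouplingMeasure

end CouplingSpace

/-! ### Translation by an approximate action. -/

theorem IteratedLimZero.exists_eventually_le {U : Ultrafilter ℕ} {p : ℕ → ℕ → ℝ}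
    (h : IteratedLimZero U p) {ε : ℝ} (hε : 0 < ε) :
    ∃ C, ∀ᶠ n in (U : Filter ℕ), p C n ≤ ε := by
  obtain ⟨q, hq, hq0⟩ := h
  obtain ⟨C, hC⟩ := ((tendsto_order.1 hq0).2 ε hε).exists
  exact ⟨C, ((tendsto_order.1 (hq C)).2 ε hC).mono fun _ h => h.le⟩

namespace IsApproxAction

variable {G : Type u} [Group G] {U : Ultrafilter ℕ} {L : Type w₁} {V : ℕ → Type w₂}
  [∀ n, Finite (V n)] {Γ : ∀ n, LabelledDigraph L (V n)} {act : ∀ n, V n → G → V n}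

theorem act_act_inv (h : IsApproxAction U Γ act) (g : G) :
    ∀ᶠ p in statFilter U V, act p.1 (act p.1 p.2 g) g⁻¹ = p.2 := by
  filter_upwards [h.act_mul g g⁻¹, h.act_one] with p h1 h2
  rw [h1, mul_inv_cancel, h2]

/-- Where `g⁻¹` undoes `g`, a point sent into `A` lies in the image of `A` under `g⁻¹`, which is no
larger than `A`. -/
theorem uniformProb_act_le (act : ∀ n, V n → G → V n) (g : G) (n : ℕ) (A : Set (V n)) :
    uniformProb {x | act n x g ∈ A} ≤
      uniformProb A + uniformProb {x | ¬ act n (act n x g) g⁻¹ = x} := by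
  refine (uniformProb_le_add (B := (fun y => act n y g⁻¹) '' A) ?_).trans
    (add_le_add_left (uniformProb_image_le _ _) _)
  intro x hx
  by_cases h : act n (act n x g) g⁻¹ = x
  · exact Or.inl ⟨_, hx, h⟩
  · exact Or.inr h

theorem tendsto_act (h : IsApproxAction U Γ act) (g : G) :
    Tendsto (fun p : Σ n, V n => (⟨p.1, act p.1 p.2 g⟩ : Σ n, V n))
      (statFilter U V) (statFilter U V) := by
  intro A hA
  have h1 : Tendsto (fun n => uniformProb {x : V n | (⟨n, x⟩ : Σ n, V n) ∉ A}) U (𝓝 0) := hA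
  have h2 := eventually_statFilter.1 (h.act_act_inv g)
  refine squeeze_zero (fun n => uniformProb_nonneg _) (fun n => ?_)
    (by simpa using h1.add h2)
  exact uniformProb_act_le act g n {x : V n | (⟨n, x⟩ : Σ n, V n) ∉ A}

theorem tendsto_uniformProb_act_sub [∀ n, Nonempty (V n)] (h : IsApproxAction U Γ act) (g : G)
    (E : ∀ n, Set (V n)) :
    Tendsto (fun n => uniformProb {x | act n x g ∈ E n} - uniformProb (E n)) U (𝓝 0) := by
  refine squeeze_zero_norm (fun n => ?_) (eventually_statFilter.1 (h.act_act_inv g))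
  -- The one-sided bound for `E n` and for its complement gives both inequalities.
  have h1 := uniformProb_act_le act g n (E n)
  have h2 := uniformProb_act_le act g n (E n)ᶜ
  have h3 : {x | act n x g ∈ (E n)ᶜ} = {x | act n x g ∈ E n}ᶜ := rfl
  rw [h3, uniformProb_compl, uniformProb_compl] at h2
  rw [Real.norm_eq_abs, abs_le]
  constructor <;> linarith

theorem statTight_act (h : IsApproxAction U Γ act) {D : Type*} {X : (Σ n, V n) → D}
    (hX : StatTight U X) (g : G) : StatTight U fun p => X ⟨p.1, act p.1 p.2 g⟩ := by
  intro ε hε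
  obtain ⟨F, hF⟩ := hX (ε / 2) (by positivity)
  refine ⟨F, ?_⟩
  filter_upwards [hF, (h.act_act_inv g).uniformProb_le (half_pos hε)] with n h1 h2
  have := uniformProb_act_le act g n {x : V n | ¬ ∃ a ∈ F, X ⟨n, x⟩ = a}
  exact this.trans (by linarith)

/-- A vertex that is statistically at bounded distance from the vertex `φ n x` is a translate of
`φ n x` by a tight group element. -/
theorem tightlyExists_of_dist_le (h : IsApproxAction U Γ act) {V' : ℕ → Type w₃}
    [∀ n, Finite (V' n)] {φ y : ∀ n, V' n → V n}
    (hφ : Tendsto (fun p : Σ n, V' n => (⟨p.1, φ p.1 p.2⟩ : Σ n, V n))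
      (statFilter U V') (statFilter U V))
    (hy : ∀ ε > 0, ∃ C : ℕ, ∀ᶠ n in (U : Filter ℕ),
      uniformProb {x : V' n | ¬ (Γ n).dist (φ n x) (y n x) ≤ C} ≤ ε) :
    TightlyExists U fun (p : Σ n, V' n) a => y p.1 p.2 = act p.1 (φ p.1 p.2) a := by
  intro ε hε
  obtain ⟨C, hC⟩ := hy (ε / 2) (by positivity)
  obtain ⟨F, hF⟩ := h.exists_of_dist_le C
  refine ⟨F, ?_⟩
  filter_upwards [hC, (hφ.eventually hF).uniformProb_le (half_pos hε)] with n h1 h2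
  refine (uniformProb_le_add (B := {x : V' n | ¬ (Γ n).dist (φ n x) (y n x) ≤ C})
    (C := {x : V' n | ¬ ∀ z, (Γ n).dist (φ n x) z ≤ C → ∃ a ∈ F, z = act n (φ n x) a})
    ?_).trans (by linarith)
  intro x hx
  by_contra hcon
  simp only [Set.mem_union, Set.mem_ofPred_eq, not_or, not_not] at hcon
  exact hx (hcon.2 _ hcon.1)

end IsApproxAction

/-! ### Cardinalities and preimages of negligible sets. -/

section Maps

set_option linter.unusedSectionVars false

variable {G : Type u} {H : Type v} [Group G] [Group H] {U : Ultrafilter ℕ} {L : Type w₁}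
  {M : Type w₂} {V : ℕ → Type w₃} {W : ℕ → Type w₄} [∀ n, Finite (V n)] [∀ n, Finite (W n)]
  [∀ n, Nonempty (V n)] [∀ n, Nonempty (W n)]
  {𝒢 : ∀ n, LabelledDigraph L (V n)} {ℋ : ∀ n, LabelledDigraph M (W n)}
  {actG : ∀ n, V n → G → V n} {actH : ∀ n, W n → H → W n} {u : ∀ n, V n → W n}

theorem StatCoarselySurjective.exists_dist_le (hu : StatCoarselySurjective U ℋ u) {ε : ℝ}
    (hε : 0 < ε) : ∃ C : ℕ, ∀ᶠ n in (U : Filter ℕ),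
      uniformProb {z : W n | ¬ ∃ x, (ℋ n).dist z (u n x) ≤ C} ≤ ε := by
  obtain ⟨C, hC⟩ := hu.exists_eventually_le hε
  refine ⟨C, hC.mono fun n hn => (uniformProb_mono ?_).trans hn⟩
  intro z hz
  simp only [Set.mem_ofPred_eq, not_exists, not_le] at hz
  exact le_iInf fun x => (hz x).le

/-- Most `z` lie near the image of `u`, hence have the form `u x·a⁻¹` with `a` in a fixed finite set
`F`. So at least half of `W n` is covered by `F.card` images of `V n`, whence the constant `2 *
F.card`. -/
theorem exists_card_le_mul_card (hH : IsApproxAction U ℋ actH)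
    (hu : StatCoarselySurjective U ℋ u) :
    ∃ K : ℕ, ∀ᶠ n in (U : Filter ℕ), (Nat.card (W n) : ℝ) ≤ K * Nat.card (V n) := by
  obtain ⟨C, hC⟩ := hu.exists_dist_le (ε := 1 / 4) (by norm_num)
  obtain ⟨F, hF⟩ := hH.exists_of_dist_le C
  have h1 : ∀ᶠ p in statFilter U W, ∀ a ∈ F, actH p.1 (actH p.1 p.2 a) a⁻¹ = p.2 :=
    (Filter.eventually_all_finset F).2 fun a _ => hH.act_act_inv a
  refine ⟨2 * F.card, ?_⟩
  filter_upwards [hC, (hF.and h1).uniformProb_le (ε := 1 / 4) (by norm_num)] with n h2 h3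
  set A : Set (W n) := (fun q : V n × H => actH n (u n q.1) q.2⁻¹) '' (Set.univ ×ˢ (F : Set H))
    with hA
  have hAc : uniformProb Aᶜ ≤ 1 / 2 := by
    refine (uniformProb_le_add (B := {z : W n | ¬ ∃ x, (ℋ n).dist z (u n x) ≤ C})
      (C := {z : W n | ¬ ((∀ y, (ℋ n).dist z y ≤ C → ∃ a ∈ F, y = actH n z a) ∧
        ∀ a ∈ F, actH n (actH n z a) a⁻¹ = z)}) ?_).trans (by linarith)
    intro z hz
    by_contra hcon
    simp only [Set.mem_union, Set.mem_ofPred_eq, not_or, not_not] at hcon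
    obtain ⟨⟨x, hx⟩, h4, h5⟩ := hcon
    obtain ⟨a, ha, hxa⟩ := h4 _ hx
    exact hz ⟨(x, a), ⟨trivial, ha⟩, by simp only [hxa]; exact h5 a ha⟩
  have hAle : A.ncard ≤ Nat.card (V n) * F.card := by
    refine (Set.ncard_image_le ((Set.toFinite _).prod F.finite_toSet)).trans ?_
    rw [Set.ncard_prod, Set.ncard_univ, Set.ncard_coe_finset]
  have hA1 : 1 / 2 ≤ uniformProb A := by
    rw [uniformProb_compl] at hAc; linarith
  have hpos : (0 : ℝ) < Nat.card (W n) := by exact_mod_cast Nat.card_pos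
  rw [uniformProb, le_div_iff₀ hpos] at hA1
  have hAle' : (A.ncard : ℝ) ≤ Nat.card (V n) * F.card := by exact_mod_cast hAle
  push_cast
  linarith

theorem ncard_le_mul_ncard_image {X : Type w₁} {Y : Type w₂} [Finite X] (f : X → Y) (A : Set X)
    (N : ℕ) (h : ∀ x ∈ A, (f ⁻¹' {f x}).ncard ≤ N) : A.ncard ≤ N * (f '' A).ncard := by
  classical
  have hA := Set.toFinite A
  have := Finset.card_le_mul_card_image (f := f) hA.toFinset N (fun b hb => by
    obtain ⟨x, hx, rfl⟩ := Finset.mem_image.1 hb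
    refine le_trans ?_ (h x (hA.mem_toFinset.1 hx))
    rw [← Set.ncard_coe_finset]
    refine Set.ncard_le_ncard ?_ (Set.toFinite _)
    intro y hy
    exact (Finset.mem_filter.1 (Finset.mem_coe.1 hy)).2)
  rw [Set.ncard_eq_toFinset_card A hA, ← Set.ncard_coe_finset (hA.toFinset.image f)] at *
  simpa using this

/-- A statistically coarsely injective map pulls small sets back to small sets. -/
theorem tendsto_statFilter_map (hG : IsApproxAction U 𝒢 actG) (hu : StatCoarselyInjective U 𝒢 u)
    {K : ℕ} (hK : ∀ᶠ n in (U : Filter ℕ), (Nat.card (W n) : ℝ) ≤ K * Nat.card (V n)) :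
    Tendsto (fun p : Σ n, V n => (⟨p.1, u p.1 p.2⟩ : Σ n, W n))
      (statFilter U V) (statFilter U W) := by
  intro A hA
  refine eventually_statFilter_of_le (Q := fun p => (⟨p.1, u p.1 p.2⟩ : Σ n, W n) ∈ A)
    fun ε hε => ?_
  obtain ⟨C, hC⟩ := hu.exists_eventually_le (show 0 < ε / 3 by positivity)
  obtain ⟨F, hF⟩ := hG.exists_of_dist_le C
  have hA' : ∀ᶠ p in statFilter U W, p ∈ A := hA
  filter_upwards [hC, hF.uniformProb_le (show 0 < ε / 3 by positivity), hK,
    hA'.uniformProb_le (show 0 < ε / (3 * (F.card * K + 1)) by positivity)] with n h1 h2 h3 h4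
  -- `B` keeps the bad points whose fibre lies in their `F`-translates. Fibres through `B` have at
  -- most `F.card` points, so `B` is at most `F.card` times as large as the bad set in `W n`; the
  -- bound `K` then converts proportions in `W n` into proportions in `V n`.
  set B : Set (V n) := {x | (⟨n, u n x⟩ : Σ n, W n) ∉ A ∧
    ∀ y ∈ u n ⁻¹' {u n x}, ∃ a ∈ F, y = actG n x a} with hB
  have hBle : B.ncard ≤ F.card * {z : W n | (⟨n, z⟩ : Σ n, W n) ∉ A}.ncard := by
    refine (ncard_le_mul_ncard_image (u n) B F.card fun x hx => ?_).trans
      (Nat.mul_le_mul_left _ (Set.ncard_le_ncard ?_ (Set.toFinite _)))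
    · have : u n ⁻¹' {u n x} ⊆ (fun a => actG n x a) '' (F : Set G) := by
        intro y hy
        obtain ⟨a, ha, rfl⟩ := hx.2 y hy
        exact ⟨a, ha, rfl⟩
      refine (Set.ncard_le_ncard this (F.finite_toSet.image _)).trans ?_
      exact (Set.ncard_image_le F.finite_toSet).trans (Set.ncard_coe_finset F).le
    · rintro _ ⟨x, hx, rfl⟩
      exact hx.1
  have hVpos : (0 : ℝ) < Nat.card (V n) := by exact_mod_cast Nat.card_pos
  have hWpos : (0 : ℝ) < Nat.card (W n) := by exact_mod_cast Nat.card_pos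
  have hBprob : uniformProb B ≤ ε / 3 := by
    rw [uniformProb, div_le_iff₀ hVpos]
    rw [uniformProb, div_le_iff₀ hWpos] at h4
    have h5 : (B.ncard : ℝ) ≤ F.card * {z : W n | (⟨n, z⟩ : Σ n, W n) ∉ A}.ncard := by
      exact_mod_cast hBle
    calc (B.ncard : ℝ) ≤ F.card * {z : W n | (⟨n, z⟩ : Σ n, W n) ∉ A}.ncard := h5
      _ ≤ F.card * (ε / (3 * (F.card * K + 1)) * (K * Nat.card (V n))) := by
        gcongr; exact h4.trans (by gcongr)
      _ = (F.card * K / (F.card * K + 1)) * (ε / 3 * Nat.card (V n)) := by field_simp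
      _ ≤ 1 * (ε / 3 * Nat.card (V n)) := by
        gcongr
        exact div_le_one_of_le₀ (by linarith) (by positivity)
      _ = _ := one_mul _
  refine (uniformProb_le_add (B := B) (C := {x : V n | ((C : ℕ∞) ≤ (𝒢 n).diam (u n ⁻¹' {u n x}))} ∪
    {x : V n | ¬ ∀ y, (𝒢 n).dist x y ≤ C → ∃ a ∈ F, y = actG n x a}) ?_).trans ?_
  · intro x hx
    by_contra hcon
    simp only [Set.mem_union, Set.mem_ofPred_eq, not_or, not_not, not_le] at hcon
    obtain ⟨h5, h6, h7⟩ := hcon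
    exact h5 ⟨hx, fun y hy => h7 y 
      (((𝒢 n).dist_le_diam (A := u n ⁻¹' {u n x}) rfl hy).trans h6.le)⟩
  · have := uniformProb_union_le {x : V n | ((C : ℕ∞) ≤ (𝒢 n).diam (u n ⁻¹' {u n x}))}
      {x : V n | ¬ ∀ y, (𝒢 n).dist x y ≤ C → ∃ a ∈ F, y = actG n x a}
    linarith

end Maps

/-! ### Local descriptions of the maps and of a nearest-point section. -/

section LocalDescription

set_option linter.unusedSectionVars false

variable {G : Type u} {H : Type v} [Group G] [Group H] {U : Ultrafilter ℕ} {L : Type w₁}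
  {M : Type w₂} {V : ℕ → Type w₃} {W : ℕ → Type w₄} [∀ n, Finite (V n)] [∀ n, Finite (W n)]
  [∀ n, Nonempty (V n)] [∀ n, Nonempty (W n)]
  {𝒢 : ∀ n, LabelledDigraph L (V n)} {ℋ : ∀ n, LabelledDigraph M (W n)}
  {actG : ∀ n, V n → G → V n} {actH : ∀ n, W n → H → W n} {u : ∀ n, V n → W n}
  {s : ∀ n, W n → V n} {f : ∀ n, V n → CouplingSpace G H}

/-- The pairs of maps `f n x` describe the maps `u n` and `s n` as seen from `x` and `u n x`. -/
structure IsLocalDescription (U : Ultrafilter ℕ) (actG : ∀ n, V n → G → V n)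
    (actH : ∀ n, W n → H → W n) (u : ∀ n, V n → W n) (s : ∀ n, W n → V n)
    (f : ∀ n, V n → CouplingSpace G H) : Prop where
  tight_fst : ∀ g, StatTight U fun p : Σ n, V n => (f p.1 p.2).fst g
  tight_snd : ∀ h, StatTight U fun p : Σ n, V n => (f p.1 p.2).snd h
  map_act : ∀ g, ∀ᶠ p in statFilter U V,
    u p.1 (actG p.1 p.2 g) = actH p.1 (u p.1 p.2) ((f p.1 p.2).fst g)
  section_act : ∀ h, ∀ᶠ p in statFilter U V,
    s p.1 (actH p.1 (u p.1 p.2) h) = actG p.1 p.2 ((f p.1 p.2).snd h)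

theorem tightlyExists_map_act (hG : IsApproxAction U 𝒢 actG) (hH : IsApproxAction U ℋ actH)
    (hu : StatLipschitz U 𝒢 ℋ u)
    (hmap : Tendsto (fun p : Σ n, V n => (⟨p.1, u p.1 p.2⟩ : Σ n, W n))
      (statFilter U V) (statFilter U W)) (g : G) :
    TightlyExists U fun (p : Σ n, V n) h =>
      u p.1 (actG p.1 p.2 g) = actH p.1 (u p.1 p.2) h := by
  refine hH.tightlyExists_of_dist_le (y := fun n x => u n (actG n x g)) hmap fun ε hε => ?_
  obtain ⟨r, hr⟩ := hG.dist_act_le g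
  obtain ⟨C, hC⟩ := (hu r).exists_eventually_le hε
  refine ⟨C, hC.mono fun n hn => (uniformProb_mono ?_).trans hn⟩
  intro x hx
  exact (not_le.1 hx).le.trans ((ℋ n).dist_le_diam
    (Set.mem_image_of_mem _ ((𝒢 n).mem_ball_self x r)) (Set.mem_image_of_mem _ (hr n x)))

/-- The point `z = u x·h` is within `r` of `u x`, so the nearest image point `u (s z)` is within `r`
of `z` and within `r + r` of `u x`. Expansivity then bounds the distance from `x` to `s z`. -/
theorem tightlyExists_section_act (hG : IsApproxAction U 𝒢 actG) (hH : IsApproxAction U ℋ actH)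
    (hu : StatExpansive U 𝒢 ℋ u)
    (hs : ∀ n z x, (ℋ n).dist z (u n (s n z)) ≤ (ℋ n).dist z (u n x)) (h : H) :
    TightlyExists U fun (p : Σ n, V n) a =>
      s p.1 (actH p.1 (u p.1 p.2) h) = actG p.1 p.2 a := by
  refine hG.tightlyExists_of_dist_le (φ := fun n x => x)
    (y := fun n x => s n (actH n (u n x) h)) tendsto_id fun ε hε => ?_
  obtain ⟨r, hr⟩ := hH.dist_act_le h
  obtain ⟨C, hC⟩ := (hu (r + r)).exists_eventually_le hε
  refine ⟨C, hC.mono fun n hn => (uniformProb_mono ?_).trans hn⟩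
  intro x hx
  refine (not_le.1 hx).le.trans ((𝒢 n).dist_le_diam ((ℋ n).mem_ball_self _ _) ?_)
  have h1 := hr n (u n x)
  have h2 := hs n (actH n (u n x) h) x
  rw [(ℋ n).dist_comm _ (u n x)] at h2
  change (ℋ n).dist (u n x) (u n (s n (actH n (u n x) h))) ≤ ((r + r : ℕ) : ℕ∞)
  push_cast
  exact ((ℋ n).dist_triangle _ _ _).trans (add_le_add h1 (h2.trans h1))

theorem exists_isLocalDescription [Countable G] [Countable H] (hG : IsApproxAction U 𝒢 actG)
    (hH : IsApproxAction U ℋ actH)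
    (hlip : StatLipschitz U 𝒢 ℋ u) (hexp : StatExpansive U 𝒢 ℋ u)
    (hmap : Tendsto (fun p : Σ n, V n => (⟨p.1, u p.1 p.2⟩ : Σ n, W n))
      (statFilter U V) (statFilter U W))
    (hs : ∀ n z x, (ℋ n).dist z (u n (s n z)) ≤ (ℋ n).dist z (u n x)) :
    ∃ f : ∀ n, V n → CouplingSpace G H, IsLocalDescription U actG actH u s f := by
  obtain ⟨pickH, hpickH⟩ := exists_tight_choice H
  obtain ⟨pickG, hpickG⟩ := exists_tight_choice G
  have h1 := fun g => (tightlyExists_map_act hG hH hlip hmap g).exists_statTight hpickH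
  have h2 := fun h => (tightlyExists_section_act hG hH hexp hs h).exists_statTight hpickG
  exact ⟨fun n x => CouplingSpace.mk
    (fun g => pickH fun h => u n (actG n x g) = actH n (u n x) h)
    (fun h => pickG fun a => s n (actH n (u n x) h) = actG n x a),
    fun g => (h1 g).1, fun h => (h2 h).1, fun g => (h1 g).2, fun h => (h2 h).2⟩

namespace IsLocalDescription

variable (hf : IsLocalDescription U actG actH u s f) (hG : IsApproxAction U 𝒢 actG)
  (hH : IsApproxAction U ℋ actH)
  (hmap : Tendsto (fun p : Σ n, V n => (⟨p.1, u p.1 p.2⟩ : Σ n, W n))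
    (statFilter U V) (statFilter U W))

include hf hG hH hmap

theorem fst_one : ∀ᶠ p in statFilter U V, (f p.1 p.2).fst 1 = 1 := by
  refine (hf.tight_fst 1).eventually fun c => ?_
  filter_upwards [hf.map_act 1, hG.act_one, hmap.eventually hH.act_one,
    hmap.eventually (hH.act_inj c 1)] with p h1 h2 h3 h4 h5
  rw [h5]
  apply h4
  rw [h3, ← h5, ← h1, h2]

/-- Both sides come from writing `u (x·g·g')` as a translate of `u x` in two ways and cancelling by
freeness. The action laws hold only for fixed group elements, so the tight random values are first
frozen to constants `a`, `b`, `c`. -/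
theorem fst_act (g g' : G) : ∀ᶠ p in statFilter U V,
    (f p.1 (actG p.1 p.2 g)).fst g' = (CouplingSpace.reroot g (f p.1 p.2)).fst g' := by
  refine (hf.tight_fst g).eventually fun a => (hG.statTight_act (hf.tight_fst g') g).eventually
    fun b => (hf.tight_fst (g * g')).eventually fun c => ?_
  filter_upwards [hf.map_act g, (hG.tendsto_act g).eventually (hf.map_act g'), hG.act_mul g g',
    hf.map_act (g * g'), hmap.eventually (hH.act_mul a b),
    hmap.eventually (hH.act_inj (a * b) c)] with p h1 h2 h3 h4 h5 h6 hc hb ha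
  rw [CouplingSpace.reroot_fst, ha, hb, hc]
  rw [ha] at h1
  rw [hb, h1, h3, h5, h4, hc] at h2
  rw [← h6 h2.symm]
  group

/-- The same argument, with `s (u (x·g)·h)` written as a translate of `x` in two ways. -/
theorem snd_act (g : G) (h : H) : ∀ᶠ p in statFilter U V,
    (f p.1 (actG p.1 p.2 g)).snd h = (CouplingSpace.reroot g (f p.1 p.2)).snd h := by
  refine (hf.tight_fst g).eventually fun c => (hG.statTight_act (hf.tight_snd h) g).eventually
    fun d => (hf.tight_snd (c * h)).eventually fun e => ?_
  filter_upwards [hf.map_act g, (hG.tendsto_act g).eventually (hf.section_act h),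
    hG.act_mul g d, hf.section_act (c * h), hmap.eventually (hH.act_mul c h),
    hG.act_inj (g * d) e] with p h1 h2 h3 h4 h5 h6 he hd hc
  rw [CouplingSpace.reroot_snd, hc, hd, he]
  rw [hc] at h1
  rw [hd, h1, h3, h5, h4, he] at h2
  rw [← h6 h2.symm]
  group

omit hH hmap in
/-- The second map sends `h` to `1` exactly where the section sends the `h`-translate of `u n x`
back to `x`. -/
theorem snd_eq_one_iff (h : H) : ∀ᶠ p in statFilter U V,
    (f p.1 p.2).snd h = 1 ↔ s p.1 (actH p.1 (u p.1 p.2) h) = p.2 := by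
  refine (hf.tight_snd h).eventually fun e => ?_
  filter_upwards [hf.section_act h, hG.act_inj e 1, hG.act_one] with p h1 h2 h3 he
  rw [he] at h1 ⊢
  rw [h1]
  exact ⟨fun h => by rw [h, h3], fun h => h2 (by rw [h, h3])⟩

/-- If the images of the maps `u n` are uniformly dense, the section sends a translate `u n x * h`
to `x` for finitely many `h` only. -/
theorem exists_finset_snd_ne_one
    (hs : ∀ n z x, (ℋ n).dist z (u n (s n z)) ≤ (ℋ n).dist z (u n x)) {C : ℕ}
    (hC : ∀ n, ∀ z : W n, ∃ x : V n, (ℋ n).dist z (u n x) ≤ C) :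
    ∃ F : Finset H, ∀ h ∉ F, ∀ᶠ p in statFilter U V, (f p.1 p.2).snd h ≠ 1 := by
  obtain ⟨F, hF⟩ := hH.exists_of_dist_le C
  refine ⟨F, fun h hh => ?_⟩
  have h1 : ∀ᶠ p in statFilter U W, ∀ a ∈ F, actH p.1 p.2 h = actH p.1 p.2 a → h = a :=
    (Filter.eventually_all_finset F).2 fun a _ => hH.act_inj h a
  filter_upwards [hf.snd_eq_one_iff hG h, hmap.eventually hF, hmap.eventually h1]
    with p h2 h3 h4 h5
  have h6 := h2.1 h5
  obtain ⟨x, hx⟩ := hC p.1 (actH p.1 (u p.1 p.2) h)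
  have h7 := (hs p.1 _ x).trans hx
  rw [h6, (ℋ p.1).dist_comm] at h7
  obtain ⟨a, ha, hha⟩ := h3 _ h7
  exact hh (h4 a ha hha ▸ ha)

/-- If the point-preimages of the maps `u n` are uniformly bounded, the section moves `u n x` to
a vertex at bounded distance from `x`. -/
theorem exists_finset_snd_one_mem
    (hs : ∀ n z x, (ℋ n).dist z (u n (s n z)) ≤ (ℋ n).dist z (u n x)) {C : ℕ}
    (hC : ∀ n, ∀ z : W n, (𝒢 n).diam (u n ⁻¹' {z}) ≤ C) :
    ∃ F : Finset G, ∀ᶠ p in statFilter U V, (f p.1 p.2).snd 1 ∈ F := by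
  obtain ⟨F, hF⟩ := hG.exists_of_dist_le C
  refine ⟨F, (hf.tight_snd 1).eventually fun e => ?_⟩
  have h1 : ∀ᶠ p in statFilter U V, ∀ a ∈ F, actG p.1 p.2 e = actG p.1 p.2 a → e = a :=
    (Filter.eventually_all_finset F).2 fun a _ => hG.act_inj e a
  filter_upwards [hf.section_act 1, hmap.eventually hH.act_one, hF, h1] with p h2 h3 h4 h5 he
  rw [he] at h2 ⊢
  rw [h3] at h2
  -- Since `u x` is itself an image point, its nearest image point is at distance zero, so `s (u x)`
  -- lies in the fibre of `x`.
  have h6 := hs p.1 (u p.1 p.2) p.2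
  rw [LabelledDigraph.dist_self, nonpos_iff_eq_zero, LabelledDigraph.dist_eq_zero_iff] at h6
  have h7 := ((𝒢 p.1).dist_le_diam (A := u p.1 ⁻¹' {u p.1 p.2}) (x := p.2)
    (y := s p.1 (u p.1 p.2)) rfl h6.symm).trans (hC p.1 _)
  obtain ⟨a, ha, haa⟩ := h4 _ h7
  exact h5 a ha (h2.symm.trans haa) ▸ ha

theorem snd_of_bijective
    (hs : ∀ n z x, (ℋ n).dist z (u n (s n z)) ≤ (ℋ n).dist z (u n x))
    (hb : ∀ n, Function.Bijective (u n)) :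
    (∀ᶠ p in statFilter U V, (f p.1 p.2).snd 1 = 1) ∧
      ∀ h : H, h ≠ 1 → ∀ᶠ p in statFilter U V, (f p.1 p.2).snd h ≠ 1 := by
  -- Every `z` is an image point, so the section is a right inverse of `u`, and by injectivity its
  -- inverse.
  have hus : ∀ n z, u n (s n z) = z := by
    intro n z
    obtain ⟨x, rfl⟩ := (hb n).2 z
    have h6 := hs n (u n x) x
    rw [LabelledDigraph.dist_self, nonpos_iff_eq_zero, LabelledDigraph.dist_eq_zero_iff] at h6
    exact h6.symm
  constructor
  · filter_upwards [hf.snd_eq_one_iff hG 1, hmap.eventually hH.act_one] with p h1 h2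
    rw [h1, h2]
    exact (hb p.1).1 (hus _ _)
  · intro h hne
    filter_upwards [hf.snd_eq_one_iff hG h, hmap.eventually (hH.act_inj h 1),
      hmap.eventually hH.act_one] with p h1 h2 h3 h4
    have h5 := hus p.1 (actH p.1 (u p.1 p.2) h)
    rw [h1.1 h4] at h5
    exact hne (h2 (by rw [h3, ← h5]))

end IsLocalDescription

end LocalDescription

/-! ### The limit law and its invariance. -/

namespace CouplingSpace

section Limit

theorem mk_fst_snd {G : Type u} {H : Type v} (ω : CouplingSpace G H) : mk ω.fst ω.snd = ω := rfl

set_option linter.unusedSectionVars false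

variable {G : Type u} {H : Type v} [TopologicalSpace G] [TopologicalSpace H] [MeasurableSpace G]
  [MeasurableSpace H] [DiscreteTopology G] [DiscreteTopology H] [BorelSpace G] [BorelSpace H]
  [Countable G] [Countable H] [Group G] [Group H] {V : ℕ → Type w₃} [∀ n, Finite (V n)]
  [∀ n, Nonempty (V n)] {U : Ultrafilter ℕ} {f : ∀ n, V n → CouplingSpace G H}

/-- To use one product with one alphabet, both maps are merged into a map `G ⊕ H → G × H`, the
unused component being padded with `1`. -/
theorem exists_ultralimit (hfst : ∀ g, StatTight U fun p : Σ n, V n => (f p.1 p.2).fst g)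
    (hsnd : ∀ h, StatTight U fun p : Σ n, V n => (f p.1 p.2).snd h) :
    ∃ P : Measure (CouplingSpace G H), IsProbabilityMeasure P ∧ ∀ E, IsClopen E →
      Tendsto (fun n => uniformProb {x | f n x ∈ E}) U (𝓝 (P.real E)) := by
  classical
  have hdG : DiscreteMeasurableSpace G := ⟨fun s => (isOpen_discrete s).measurableSet⟩
  have hdH : DiscreteMeasurableSpace H := ⟨fun s => (isOpen_discrete s).measurableSet⟩
  obtain ⟨P, hP, hlim⟩ := exists_ultralimit_measure (U := U) (ι := G ⊕ H) (D := G × H)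
    (fun n x i => Sum.elim (fun g => ((1 : G), (f n x).fst g)) (fun h => ((f n x).snd h, (1 : H))) i)
    (by
      rintro (g | h) ε hε
      · obtain ⟨F, hF⟩ := hfst g ε hε
        refine ⟨F.image fun a => (1, a), hF.mono fun n hn => (uniformProb_mono ?_).trans hn⟩
        rintro x hx ⟨a, ha, hxa⟩
        exact hx ⟨(1, a), Finset.mem_image_of_mem _ ha, Prod.ext rfl hxa⟩
      · obtain ⟨F, hF⟩ := hsnd h ε hε
        refine ⟨F.image fun a => (a, 1), hF.mono fun n hn => (uniformProb_mono ?_).trans hn⟩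
        rintro x hx ⟨a, ha, hxa⟩
        exact hx ⟨(a, 1), Finset.mem_image_of_mem _ ha, Prod.ext hxa rfl⟩)
  set π : (G ⊕ H → G × H) → CouplingSpace G H :=
    fun ω => mk (fun g => (ω (Sum.inl g)).2) (fun h => (ω (Sum.inr h)).1) with hπ
  have hcont : Continuous π := continuous_iff.2
    ⟨fun g => (continuous_apply (A := fun _ : G ⊕ H => G × H) (Sum.inl g)).snd,
      fun h => (continuous_apply (A := fun _ : G ⊕ H => G × H) (Sum.inr h)).fst⟩
  refine ⟨P.map π, Measure.isProbabilityMeasure_map hcont.measurable.aemeasurable,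
    fun E hE => ?_⟩
  rw [measureReal_def, Measure.map_apply hcont.measurable hE.isOpen.measurableSet]
  have h1 := hlim _ (hE.preimage hcont)
  refine h1.congr fun n => congrArg uniformProb (Set.ext fun x => ?_)
  exact iff_of_eq (congrArg (· ∈ E) (mk_fst_snd (f n x)))

variable {P : Measure (CouplingSpace G H)} [IsProbabilityMeasure P]

theorem ae_mem_of_eventually
    (hlim : ∀ E, IsClopen E → Tendsto (fun n => uniformProb {x | f n x ∈ E}) U (𝓝 (P.real E)))
    {E : Set (CouplingSpace G H)} (hE : IsClopen E) (h : ∀ᶠ p in statFilter U V, f p.1 p.2 ∈ E) :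
    ∀ᵐ ω ∂P, ω ∈ E := by
  rw [ae_iff]
  have h0 : Tendsto (fun n => uniformProb {x | f n x ∈ Eᶜ}) U (𝓝 0) :=
    (eventually_statFilter (Q := fun p => f p.1 p.2 ∈ E)).1 h
  have h1 : P.real Eᶜ = 0 := tendsto_nhds_unique (hlim Eᶜ hE.compl) h0
  rw [measureReal_def, ENNReal.toReal_eq_zero_iff] at h1
  exact h1.resolve_right (measure_ne_top P _)

theorem isClopen_fst_eq (g : G) (c : H) : IsClopen {ω : CouplingSpace G H | ω.fst g = c} :=
  (isClopen_discrete {c}).preimage (continuous_fst_apply g)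

theorem isClopen_snd_mem (h : H) (A : Set G) : IsClopen {ω : CouplingSpace G H | ω.snd h ∈ A} :=
  (isClopen_discrete A).preimage (continuous_snd_apply h)

theorem isClopen_snd_eq (h : H) (c : G) : IsClopen {ω : CouplingSpace G H | ω.snd h = c} :=
  isClopen_snd_mem h {c}

/-- The clopen sets that depend on finitely many coordinates. -/
def finitaryClopens (G : Type u) (H : Type v) [TopologicalSpace G] [TopologicalSpace H] :
    Set (Set (CouplingSpace G H)) :=
  {E | IsClopen E ∧ ∃ (I : Finset G) (J : Finset H), ∀ ω ω' : CouplingSpace G H,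
    (∀ g ∈ I, ω.fst g = ω'.fst g) → (∀ h ∈ J, ω.snd h = ω'.snd h) → (ω ∈ E ↔ ω' ∈ E)}

theorem isPiSystem_finitaryClopens : IsPiSystem (finitaryClopens G H) := by
  classical
  rintro E ⟨hE, I, J, h⟩ E' ⟨hE', I', J', h'⟩ -
  refine ⟨hE.inter hE', I ∪ I', J ∪ J', fun ω ω' h1 h2 => ?_⟩
  exact and_congr
    (h ω ω' (fun g hg => h1 g (Finset.mem_union_left _ hg))
      fun g hg => h2 g (Finset.mem_union_left _ hg))
    (h' ω ω' (fun g hg => h1 g (Finset.mem_union_right _ hg))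
      fun g hg => h2 g (Finset.mem_union_right _ hg))

theorem generateFrom_finitaryClopens :
    (inferInstance : MeasurableSpace (CouplingSpace G H)) =
      MeasurableSpace.generateFrom (finitaryClopens G H) := by
  refine le_antisymm ?_ (MeasurableSpace.generateFrom_le fun E hE => hE.1.isOpen.measurableSet)
  have hdG : DiscreteMeasurableSpace G := ⟨fun s => (isOpen_discrete s).measurableSet⟩
  have hdH : DiscreteMeasurableSpace H := ⟨fun s => (isOpen_discrete s).measurableSet⟩
  have h1 : @Measurable _ _ (MeasurableSpace.generateFrom (finitaryClopens G H)) _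
      (id : CouplingSpace G H → CouplingSpace G H) := by
    refine (measurable_iff (mX := MeasurableSpace.generateFrom (finitaryClopens G H))).2 ⟨fun g => ?_, fun h => ?_⟩
    · refine @measurable_to_countable' _ _ (_) _ (_) _ fun c =>
        MeasurableSpace.measurableSet_generateFrom
          ⟨isClopen_fst_eq g c, {g}, ∅, fun ω ω' h1 _ => ?_⟩
      change ω.fst g = c ↔ ω'.fst g = c
      rw [h1 g (by simp)]
    · refine @measurable_to_countable' _ _ (_) _ (_) _ fun c =>
        MeasurableSpace.measurableSet_generateFrom
          ⟨isClopen_snd_eq h c, ∅, {h}, fun ω ω' _ h1 => ?_⟩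
      change ω.snd h = c ↔ ω'.snd h = c
      rw [h1 h (by simp)]
  intro E hE
  exact h1 hE

/-- The local identities hold with limiting probability one only for finitely many coordinates at a
time, so the two laws are compared on `finitaryClopens`, a π-system that generates the σ-algebra. -/
theorem map_reroot_eq
    (hlim : ∀ E, IsClopen E → Tendsto (fun n => uniformProb {x | f n x ∈ E}) U (𝓝 (P.real E)))
    {τ : ∀ n, V n → V n}
    (hτ : ∀ E : ∀ n, Set (V n),
      Tendsto (fun n => uniformProb {x | τ n x ∈ E n} - uniformProb (E n)) U (𝓝 0)) (g : G)
    (hfst : ∀ g', ∀ᶠ p in statFilter U V,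
      (f p.1 (τ p.1 p.2)).fst g' = (reroot g (f p.1 p.2)).fst g')
    (hsnd : ∀ h, ∀ᶠ p in statFilter U V,
      (f p.1 (τ p.1 p.2)).snd h = (reroot g (f p.1 p.2)).snd h) :
    P.map (reroot g) = P := by
  have hm : Measurable (reroot g : CouplingSpace G H → _) := (continuous_reroot g).measurable
  have : IsProbabilityMeasure (P.map (reroot g)) :=
    Measure.isProbabilityMeasure_map hm.aemeasurable
  refine ext_of_generate_finite _ generateFrom_finitaryClopens isPiSystem_finitaryClopens ?_
    (by simp)
  rintro E ⟨hE, I, J, hIJ⟩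
  rw [Measure.map_apply hm hE.isOpen.measurableSet]
  refine (measureReal_eq_measureReal_iff).1 ?_
  have h1 := hlim _ (hE.preimage (continuous_reroot g))
  have h2 := (hlim E hE).add (hτ fun n => {x | f n x ∈ E})
  rw [add_zero] at h2
  have h3 : ∀ᶠ p in statFilter U V, (f p.1 (τ p.1 p.2) ∈ E ↔ reroot g (f p.1 p.2) ∈ E) := by
    filter_upwards [(Filter.eventually_all_finset I).2 fun g' _ => hfst g',
      (Filter.eventually_all_finset J).2 fun h _ => hsnd h] with p h4 h5
    exact hIJ _ _ h4 h5
  refine eq_of_abs_sub_nonpos (le_of_tendsto_of_tendsto (h1.sub h2).abs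
    (eventually_statFilter.1 h3) (Eventually.of_forall fun n => ?_))
  simp only [add_sub_cancel]
  rw [abs_sub_comm]
  exact abs_uniformProb_sub_le {x | f n (τ n x) ∈ E} {x | f n x ∈ reroot g ⁻¹' E}

end Limit

end CouplingSpace

/-! ### The ratio of the cardinalities. -/

section Ratio

set_option linter.unusedSectionVars false

/-- By `h1` finite sums asymptotically stay below `r`, which with `hK` gives summability; by `h2` no
mass escapes from finite sets. -/
theorem hasSum_and_tendsto_of_bounds {ι : Type*} {a : ι → ℝ} (ha : ∀ i, 0 ≤ a i) {l : Filter ℕ}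
    [l.NeBot] {r : ℕ → ℝ} {K : ℝ} (hK : ∀ᶠ n in l, r n ≤ K)
    (h1 : ∀ F : Finset ι, ∀ ε > 0, ∀ᶠ n in l, ∑ i ∈ F, a i ≤ r n + ε)
    (h2 : ∀ ε > 0, ∃ F : Finset ι, ∀ᶠ n in l, r n ≤ ∑ i ∈ F, a i + ε) :
    Summable a ∧ Tendsto r l (𝓝 (∑' i, a i)) := by
  have hs : Summable a := by
    refine summable_of_sum_le (c := K + 1) ha fun F => ?_
    obtain ⟨n, hn, hn'⟩ := (hK.and (h1 F 1 one_pos)).exists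
    linarith
  refine ⟨hs, tendsto_order.2 ⟨fun b hb => ?_, fun b hb => ?_⟩⟩
  · obtain ⟨F, hF⟩ := ((tendsto_order.1 hs.hasSum).1 _ hb).exists
    filter_upwards [h1 F ((∑ i ∈ F, a i - b) / 2) (by linarith)] with n hn
    linarith
  · obtain ⟨F, hF⟩ := h2 ((b - ∑' i, a i) / 2) (by linarith)
    filter_upwards [hF] with n hn
    have := hs.sum_le_tsum F fun i _ => ha i
    linarith

variable {H : Type v} [Group H] {U : Ultrafilter ℕ}
  {M : Type w₂} {V : ℕ → Type w₃} {W : ℕ → Type w₄} [∀ n, Finite (V n)] [∀ n, Finite (W n)]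
  [∀ n, Nonempty (V n)] [∀ n, Nonempty (W n)]
  {ℋ : ∀ n, LabelledDigraph M (W n)}
  {actH : ∀ n, W n → H → W n} {u : ∀ n, V n → W n} {s : ∀ n, W n → V n}

theorem tightlyExists_eq_act_section (hH : IsApproxAction U ℋ actH)
    (hu : StatCoarselySurjective U ℋ u)
    (hs : ∀ n z x, (ℋ n).dist z (u n (s n z)) ≤ (ℋ n).dist z (u n x)) :
    TightlyExists U fun (p : Σ n, W n) h => p.2 = actH p.1 (u p.1 (s p.1 p.2)) h := by
  classical
  have h1 := hH.tightlyExists_of_dist_le (φ := fun n z => z) (y := fun n z => u n (s n z))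
    tendsto_id (by
      intro ε hε
      obtain ⟨C, hC⟩ := hu.exists_dist_le hε
      refine ⟨C, hC.mono fun n hn => (uniformProb_mono ?_).trans hn⟩
      rintro z hz ⟨x, hx⟩
      exact hz ((hs n z x).trans hx))
  -- Closeness yields `u (s z) = z·a`; the translation has to be inverted to express `z` through `u
  -- (s z)`.
  have h2 := h1.mono (q := fun p h => p.2 = actH p.1 (u p.1 (s p.1 p.2)) h⁻¹) (fun a => by
    filter_upwards [hH.act_act_inv a] with p h3 h4
    rw [h4, h3])
  intro ε hε
  obtain ⟨F, hF⟩ := h2 ε hε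
  refine ⟨F.image (·⁻¹), hF.mono fun n hn => (uniformProb_mono ?_).trans hn⟩
  rintro z hz ⟨a, ha, hza⟩
  exact hz ⟨a⁻¹, Finset.mem_image_of_mem _ ha, hza⟩

/-- On the set where `s (u x·h) = x`, the map `x ↦ u x·h` has the left inverse `s`, so it is
injective. A common image of two such maps has the same `x`, and freeness off the small set `B`
gives the same `h`. The images are therefore disjoint in `W n`. -/
theorem sum_uniformProb_le_ratio (hH : IsApproxAction U ℋ actH)
    (hmap : Tendsto (fun p : Σ n, V n => (⟨p.1, u p.1 p.2⟩ : Σ n, W n))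
      (statFilter U V) (statFilter U W)) (F : Finset H) {ε : ℝ} (hε : 0 < ε) :
    ∀ᶠ n in (U : Filter ℕ), ∑ h ∈ F, uniformProb {x | s n (actH n (u n x) h) = x} ≤
      (Nat.card (W n) : ℝ) / Nat.card (V n) + ε := by
  classical
  have hinj : ∀ᶠ p in statFilter U W, ∀ a ∈ F, ∀ b ∈ F, actH p.1 p.2 a = actH p.1 p.2 b → a = b :=
    (Filter.eventually_all_finset F).2 fun a _ =>
      (Filter.eventually_all_finset F).2 fun b _ => hH.act_inj a b
  filter_upwards [(hmap.eventually hinj).uniformProb_le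
    (show 0 < ε / (F.card + 1) by positivity)] with n hn
  set B : Set (V n) := {x | ¬ ∀ a ∈ F, ∀ b ∈ F, actH n (u n x) a = actH n (u n x) b → a = b} with hB
  have := Fintype.ofFinite (V n)
  have h1 : ∑ h ∈ F, ({x | s n (actH n (u n x) h) = x} \ B).ncard ≤ Nat.card (W n) := by
    have h2 : ∀ h ∈ F, ({x | s n (actH n (u n x) h) = x} \ B).ncard =
        ((fun x => actH n (u n x) h) '' ({x | s n (actH n (u n x) h) = x} \ B)).ncard := by
      intro h _
      refine (Set.InjOn.ncard_image ?_).symm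
      intro x hx y hy hxy
      rw [← hx.1, ← hy.1]
      exact congrArg (s n) hxy
    rw [Finset.sum_congr rfl h2]
    have h3 : (F : Set H).PairwiseDisjoint fun h =>
        (fun x => actH n (u n x) h) '' ({x | s n (actH n (u n x) h) = x} \ B) := by
      intro a ha b hb hab
      refine Set.disjoint_left.2 ?_
      rintro _ ⟨x, hx, rfl⟩ ⟨y, hy, hxy⟩
      have hxy' : actH n (u n y) b = actH n (u n x) a := hxy
      have h4 : y = x := by rw [← hx.1, ← hxy']; exact hy.1.symm
      subst h4
      exact hab (not_not.1 hx.2 a ha b hb hxy'.symm)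
    have h5 := Set.ncard_le_card (⋃ h ∈ F,
        (fun x => actH n (u n x) h) '' ({x | s n (actH n (u n x) h) = x} \ B))
    rw [← finsum_mem_coe_finset, ← F.finite_toSet.ncard_biUnion (fun _ _ => Set.toFinite _) h3]
    exact h5
  have h2 : ∀ h ∈ F, uniformProb {x | s n (actH n (u n x) h) = x} ≤
      (({x | s n (actH n (u n x) h) = x} \ B).ncard : ℝ) / Nat.card (V n) + ε / (F.card + 1) := by
    intro h _
    refine (uniformProb_le_add (B := {x | s n (actH n (u n x) h) = x} \ B) (C := B) ?_).trans
      (add_le_add_right hn _)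
    rw [Set.sdiff_union_self]
    exact Set.subset_union_left
  refine (Finset.sum_le_sum h2).trans ?_
  rw [Finset.sum_add_distrib, ← Finset.sum_div, Finset.sum_const, nsmul_eq_mul]
  have h3 : ∑ h ∈ F, (({x | s n (actH n (u n x) h) = x} \ B).ncard : ℝ) ≤ Nat.card (W n) := by
    exact_mod_cast h1
  have h4 : F.card * (ε / (F.card + 1)) ≤ ε := by
    rw [mul_div_assoc', div_le_iff₀ (by positivity)]
    nlinarith
  gcongr

/-- Outside a small set, `z = u x·h` with `x = s z` and `h ∈ F`; this `x` satisfies `s (u x·h) = x`,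
so these images cover `W n` up to a small set. -/
theorem ratio_le_sum_uniformProb
    (hsect : TightlyExists U fun (p : Σ n, W n) h => p.2 = actH p.1 (u p.1 (s p.1 p.2)) h)
    {K : ℕ} (hK : ∀ᶠ n in (U : Filter ℕ), (Nat.card (W n) : ℝ) ≤ K * Nat.card (V n))
    {ε : ℝ} (hε : 0 < ε) :
    ∃ F : Finset H, ∀ᶠ n in (U : Filter ℕ), (Nat.card (W n) : ℝ) / Nat.card (V n) ≤
      ∑ h ∈ F, uniformProb {x | s n (actH n (u n x) h) = x} + ε := by
  obtain ⟨F, hF⟩ := hsect (ε / (K + 1)) (by positivity)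
  refine ⟨F, ?_⟩
  filter_upwards [hF, hK] with n h1 h2
  have hVpos : (0 : ℝ) < Nat.card (V n) := by exact_mod_cast Nat.card_pos
  have hWpos : (0 : ℝ) < Nat.card (W n) := by exact_mod_cast Nat.card_pos
  set Z : Set (W n) := {z | ¬ ∃ h ∈ F, z = actH n (u n (s n z)) h} with hZ
  have h3 : Nat.card (W n) ≤ ∑ h ∈ F, {x | s n (actH n (u n x) h) = x}.ncard + Z.ncard := by
    rw [← Set.ncard_univ]
    have h4 : (Set.univ : Set (W n)) ⊆ (⋃ h ∈ F,
        (fun x => actH n (u n x) h) '' {x | s n (actH n (u n x) h) = x}) ∪ Z := by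
      intro z _
      by_cases hz : z ∈ Z
      · exact Or.inr hz
      · obtain ⟨h, hh, hzh⟩ := not_not.1 hz
        refine Or.inl (Set.mem_iUnion₂.2 ⟨h, hh, s n z, ?_, hzh.symm⟩)
        change s n (actH n (u n (s n z)) h) = s n z
        rw [← hzh]
    refine (Set.ncard_le_ncard h4 (Set.toFinite _)).trans ((Set.ncard_union_le _ _).trans ?_)
    refine Nat.add_le_add_right ((Finset.set_ncard_biUnion_le _ _).trans ?_) _
    exact Finset.sum_le_sum fun h _ => Set.ncard_image_le (Set.toFinite _)
  have h3' : (Nat.card (W n) : ℝ) ≤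
      ∑ h ∈ F, ({x | s n (actH n (u n x) h) = x}.ncard : ℝ) + Z.ncard := by exact_mod_cast h3
  have h5 : (Z.ncard : ℝ) ≤ ε * Nat.card (V n) := by
    have h6 : (Z.ncard : ℝ) ≤ ε / (K + 1) * Nat.card (W n) := (div_le_iff₀ hWpos).1 h1
    calc (Z.ncard : ℝ) ≤ ε / (K + 1) * (K * Nat.card (V n)) := h6.trans (by gcongr)
      _ = (K / (K + 1)) * (ε * Nat.card (V n)) := by field_simp
      _ ≤ 1 * (ε * Nat.card (V n)) := by
        gcongr
        exact div_le_one_of_le₀ (by linarith) (by positivity)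
      _ = _ := one_mul _
  rw [div_le_iff₀ hVpos, add_mul, Finset.sum_mul]
  refine h3'.trans (add_le_add (le_of_eq (Finset.sum_congr rfl fun h _ => ?_)) h5)
  rw [uniformProb, div_mul_cancel₀ _ hVpos.ne']

end Ratio

/-! ### Assembly of the coupling and the main theorem. -/

theorem exists_coupling_of_nonempty {G : Type u} {H : Type v} [Group G] [Group H]
    (S : Finset G) (hS : Subgroup.closure (S : Set G) = ⊤)
    (T : Finset H) (hT : Subgroup.closure (T : Set H) = ⊤)
    {V : ℕ → Type w₁} {W : ℕ → Type w₂} [∀ n, Finite (V n)] [∀ n, Finite (W n)]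
    [∀ n, Nonempty (V n)] [∀ n, Nonempty (W n)]
    (𝒢 : ∀ n, LabelledDigraph S (V n)) (ℋ : ∀ n, LabelledDigraph T (W n)) (U : Ultrafilter ℕ)
    (h𝒢 : ∀ r : ℕ, Tendsto (fun n => uniformProb (goodVertices S (𝒢 n) r)) U (𝓝 1))
    (hℋ : ∀ r : ℕ, Tendsto (fun n => uniformProb (goodVertices T (ℋ n) r)) U (𝓝 1))
    (u : ∀ n, V n → W n) (hu : StatCoarseEquivalence U 𝒢 ℋ u) :
    ∃ c : MECoupling G H,
      Tendsto (fun n => (Nat.card (W n) : ℝ≥0∞) / (Nat.card (V n) : ℝ≥0∞)) U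
        (𝓝 c.covolumeRatio) ∧
      ((∃ C : ℕ, ∀ n, ∀ z : W n, ∃ x : V n, (ℋ n).dist z (u n x) ≤ C) → c.CoboundedGToH) ∧
      ((∃ C : ℕ, ∀ n, ∀ z : W n, (𝒢 n).diam (u n ⁻¹' {z}) ≤ C) → c.CoboundedHToG) ∧
      ((∀ n, Function.Bijective (u n)) → c.IsOE) := by
  have hcG : Countable G := (Function.Surjective.countable (f := wordValue (S := S))
    fun g => exists_wordValue_eq hS g)
  have hcH : Countable H := (Function.Surjective.countable (f := wordValue (S := T))
    fun h => exists_wordValue_eq hT h)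
  let _ : TopologicalSpace G := ⊥
  let _ : TopologicalSpace H := ⊥
  let _ : MeasurableSpace G := borel G
  let _ : MeasurableSpace H := borel H
  have : DiscreteTopology G := ⟨rfl⟩
  have : DiscreteTopology H := ⟨rfl⟩
  have : BorelSpace G := ⟨rfl⟩
  have : BorelSpace H := ⟨rfl⟩
  obtain ⟨actG, hG⟩ := IsSoficApproximation.exists_isApproxAction hS h𝒢
  obtain ⟨actH, hH⟩ := IsSoficApproximation.exists_isApproxAction hT hℋ
  have hs' : ∀ n (z : W n), ∃ x₀, ∀ x, (ℋ n).dist z (u n x₀) ≤ (ℋ n).dist z (u n x) :=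
    fun n z => Finite.exists_min fun x => (ℋ n).dist z (u n x)
  choose s hs using hs'
  obtain ⟨K, hK⟩ := exists_card_le_mul_card hH hu.coarselySurjective
  have hmap := tendsto_statFilter_map hG hu.coarselyInjective hK
  obtain ⟨f, hf⟩ := exists_isLocalDescription hG hH hu.lipschitz hu.expansive hmap hs
  obtain ⟨P, hPprob, hlim⟩ := CouplingSpace.exists_ultralimit hf.tight_fst hf.tight_snd
  have hP1 : ∀ᵐ ω ∂P, ω.fst 1 = 1 := CouplingSpace.ae_mem_of_eventually hlim
    (CouplingSpace.isClopen_fst_eq 1 1) (hf.fst_one hG hH hmap)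
  have hinv : ∀ g : G, P.map (CouplingSpace.reroot g) = P := fun g =>
    CouplingSpace.map_reroot_eq hlim (τ := fun n x => actG n x g)
      (hG.tendsto_uniformProb_act_sub g) g (hf.fst_act hG hH hmap g) (hf.snd_act hG hH hmap g)
  have hzero : ∀ h : H, (∀ᶠ p in statFilter U V, (f p.1 p.2).snd h ≠ 1) →
      P {ω | ω.snd h = 1} = 0 := fun h hh =>
    measure_eq_zero_iff_ae_notMem.2 (CouplingSpace.ae_mem_of_eventually hlim
      (CouplingSpace.isClopen_snd_eq h 1).compl hh)
  have hA : ∀ h : H, Tendsto (fun n => uniformProb {x | s n (actH n (u n x) h) = x}) U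
      (𝓝 (P.real {ω | ω.snd h = 1})) := by
    intro h
    -- The limit law knows only the event `snd h = 1`; `snd_eq_one_iff` identifies it asymptotically
    -- with the event that is counted.
    have h1 := hlim _ (CouplingSpace.isClopen_snd_eq h 1)
    refine h1.congr_dist ?_
    refine squeeze_zero (fun n => dist_nonneg) (fun n => ?_)
      (eventually_statFilter.1 (hf.snd_eq_one_iff hG h))
    rw [Real.dist_eq]
    exact abs_uniformProb_sub_le {x | f n x ∈ {ω : CouplingSpace G H | ω.snd h = 1}}
      {x | s n (actH n (u n x) h) = x}
  obtain ⟨hsum, hratio⟩ := hasSum_and_tendsto_of_bounds (l := (U : Filter ℕ))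
    (a := fun h : H => P.real {ω | ω.snd h = 1})
    (r := fun n => (Nat.card (W n) : ℝ) / Nat.card (V n)) (K := K)
    (fun h => measureReal_nonneg)
    (hK.mono fun n hn => (div_le_iff₀ (by exact_mod_cast Nat.card_pos)).2 hn)
    (fun F ε hε => by
      have h1 := (tendsto_order.1 (tendsto_finsetSum F fun h _ => hA h)).1 _
        (sub_lt_self _ (half_pos hε))
      filter_upwards [h1, sum_uniformProb_le_ratio (s := s) hH hmap F (half_pos hε)] with n h2 h3
      linarith)
    (fun ε hε => by
      obtain ⟨F, hF⟩ := ratio_le_sum_uniformProb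
        (tightlyExists_eq_act_section hH hu.coarselySurjective hs) hK (half_pos hε)
      have h1 := (tendsto_order.1 (tendsto_finsetSum F fun h _ => hA h)).2 _
        (lt_add_of_pos_right _ (half_pos hε))
      refine ⟨F, ?_⟩
      filter_upwards [h1, hF] with n h2 h3
      linarith)
  have htsum : ∑' h : H, P {ω | ω.snd h = 1} =
      ENNReal.ofReal (∑' h : H, P.real {ω | ω.snd h = 1}) := by
    rw [ENNReal.ofReal_tsum_of_nonneg (fun _ => measureReal_nonneg) hsum]
    exact tsum_congr fun h => (ofReal_measureReal (measure_ne_top _ _)).symm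
  obtain ⟨c, hc1, hc2, hc3, hc4⟩ := CouplingSpace.exists_coupling hP1 hinv
    (htsum ▸ ENNReal.ofReal_lt_top) (oe := ∀ n, Function.Bijective (u n)) (fun hb => by
      obtain ⟨h1, h2⟩ := hf.snd_of_bijective hG hH hmap hs hb
      exact ⟨CouplingSpace.ae_mem_of_eventually hlim (CouplingSpace.isClopen_snd_eq 1 1) h1,
        fun h hne => hzero h (h2 h hne)⟩)
  refine ⟨c, ?_, ?_, ?_, hc4⟩
  · rw [hc1, htsum]
    refine ((ENNReal.continuous_ofReal.tendsto _).comp hratio).congr fun n => ?_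
    have hpos : (0 : ℝ) < Nat.card (V n) := by exact_mod_cast Nat.card_pos
    simp [ENNReal.ofReal_div_of_pos hpos]
  · rintro ⟨C, hC⟩
    obtain ⟨F, hF⟩ := hf.exists_finset_snd_ne_one hG hH hmap hs hC
    exact hc2 ⟨F, fun h hh => hzero h (hF h hh)⟩
  · rintro ⟨C, hC⟩
    obtain ⟨F, hF⟩ := hf.exists_finset_snd_one_mem hG hH hmap hs hC
    exact hc3 ⟨F, CouplingSpace.ae_mem_of_eventually hlim
      (CouplingSpace.isClopen_snd_mem 1 (F : Set G)) hF⟩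

theorem le_atTop_of_ne_pure {U : Ultrafilter ℕ} (hU : ∀ n, U ≠ pure n) :
    (U : Filter ℕ) ≤ atTop := by
  rw [← Nat.cofinite_eq_atTop, le_cofinite_iff_compl_singleton_mem]
  intro n
  refine Ultrafilter.compl_mem_iff_notMem.2 fun hn => ?_
  obtain ⟨_, rfl, h⟩ := Ultrafilter.eq_pure_of_finite_mem (Set.finite_singleton n) hn
  exact hU _ h

theorem IteratedLimZero.reindex {U : Ultrafilter ℕ} {p : ℕ → ℕ → ℝ} (h : IteratedLimZero U p)
    {m : ℕ → ℕ} (hm : ∀ᶠ n in (U : Filter ℕ), m n = n) :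
    IteratedLimZero U fun C n => p C (m n) := by
  obtain ⟨q, hq, hq0⟩ := h
  exact ⟨q, fun C => (hq C).congr' (hm.mono fun n hn => by simp only [hn]), hq0⟩

theorem nonempty_of_uniformProb_pos {V : Type w₁} {A : Set V} (h : 0 < uniformProb A) :
    Nonempty V := by
  by_contra hV
  rw [not_nonempty_iff] at hV
  rw [Set.eq_empty_of_isEmpty A, uniformProb_empty] at h
  exact lt_irrefl _ h

theorem theorem1p5 {G : Type u} {H : Type v} [Group G] [Group H]
    (S : Finset G) (hS : Subgroup.closure (S : Set G) = ⊤)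
    (T : Finset H) (hT : Subgroup.closure (T : Set H) = ⊤)
    {V : ℕ → Type w₁} {W : ℕ → Type w₂} [∀ n, Finite (V n)] [∀ n, Finite (W n)]
    (𝒢 : ∀ n, LabelledDigraph S (V n)) (ℋ : ∀ n, LabelledDigraph T (W n))
    (h𝒢 : IsSoficApproximation S 𝒢) (hℋ : IsSoficApproximation T ℋ)
    (U : Ultrafilter ℕ) (hU : ∀ n, U ≠ pure n)
    (u : ∀ n, V n → W n) (hu : StatCoarseEquivalence U 𝒢 ℋ u) :
    ∃ c : MECoupling G H,
      Tendsto (fun n => (Nat.card (W n) : ℝ≥0∞) / (Nat.card (V n) : ℝ≥0∞)) U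
        (𝓝 c.covolumeRatio) ∧
      ((∃ C : ℕ, ∀ n, ∀ z : W n, ∃ x : V n, (ℋ n).dist z (u n x) ≤ C) → c.CoboundedGToH) ∧
      ((∃ C : ℕ, ∀ n, ∀ z : W n, (𝒢 n).diam (u n ⁻¹' {z}) ≤ C) → c.CoboundedHToG) ∧
      ((∀ n, Function.Bijective (u n)) → c.IsOE) := by
  classical
  have hle := le_atTop_of_ne_pure hU
  have hne : ∀ᶠ n in (U : Filter ℕ), Nonempty (V n) ∧ Nonempty (W n) := by
    filter_upwards [(tendsto_order.1 ((h𝒢 0).mono_left hle)).1 0 one_pos,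
      (tendsto_order.1 ((hℋ 0).mono_left hle)).1 0 one_pos] with n h1 h2
    exact ⟨nonempty_of_uniformProb_pos h1, nonempty_of_uniformProb_pos h2⟩
  obtain ⟨n₀, hn₀⟩ := hne.exists
  -- Vertex sets may be empty, but only for a `U`-negligible set of indices. Those indices are
  -- replaced by a good one `n₀`, which changes no limit along `U` and keeps the hypotheses imposed
  -- on all `n`.
  set m : ℕ → ℕ := fun n => if Nonempty (V n) ∧ Nonempty (W n) then n else n₀ with hm
  have hmn : ∀ᶠ n in (U : Filter ℕ), m n = n := hne.mono fun n hn => if_pos hn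
  have hm' : ∀ n, Nonempty (V (m n)) ∧ Nonempty (W (m n)) := by
    intro n
    by_cases h : Nonempty (V n) ∧ Nonempty (W n)
    · rw [hm]; simp only [if_pos h]; exact h
    · rw [hm]; simp only [if_neg h]; exact hn₀
  have : ∀ n, Nonempty (V (m n)) := fun n => (hm' n).1
  have : ∀ n, Nonempty (W (m n)) := fun n => (hm' n).2
  obtain ⟨c, h1, h2, h3, h4⟩ := exists_coupling_of_nonempty S hS T hT
    (fun n => 𝒢 (m n)) (fun n => ℋ (m n)) U
    (fun r => ((h𝒢 r).mono_left hle).congr' (hmn.mono fun n hn =>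
      congrArg (fun k => uniformProb (goodVertices S (𝒢 k) r)) hn.symm))
    (fun r => ((hℋ r).mono_left hle).congr' (hmn.mono fun n hn =>
      congrArg (fun k => uniformProb (goodVertices T (ℋ k) r)) hn.symm))
    (fun n => u (m n))
    ⟨fun r => (hu.lipschitz r).reindex hmn, fun r => (hu.expansive r).reindex hmn,
      hu.coarselyInjective.reindex hmn, hu.coarselySurjective.reindex hmn⟩
  refine ⟨c, h1.congr' (hmn.mono fun n hn => by simp only [hn]), ?_, ?_, fun hb => h4 fun n => hb (m n)⟩
  · rintro ⟨C, hC⟩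
    exact h2 ⟨C, fun n => hC (m n)⟩
  · rintro ⟨C, hC⟩
    exact h3 ⟨C, fun n => hC (m n)⟩
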